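/- Let $F:\mathbb R^3\to\mathbb R$, $(x,t,e)\mapsto F(x,t,e)$, be smooth with $F(-x,t,e)=-F(x,t,e)$, $F(x,-t,e)=F(x,t,e)$, $F(x,t+2\pi,e)=F(x,t,e)$, $F(x,t,0)=f(x)$ for all $x,t,e$, and $xf(x)>0$ for $x\neq0$. Put $U(x)=\int_0^x f(u)\,du$, and for $0<h<\sup U$ let $T(h)>0$ be the minimal period of the periodic orbit $\tfrac12\dot x^2+U(x)=h$ of $\ddot x+f(x)=0$. Let $m,p\ge1$ be integers and let $0<h_{m,p}<\sup U$ satisfy $T(h_{m,p})=2m\pi/p$ and $T'(h_{m,p})\ne0$. Let $\eta_{m,p}=\sqrt{2h_{m,p}}$. Let $e_0>0$, let $V:[0,e_0)\to\mathbb R$ be continuous with $V(0)=\eta_{m,p}$, and suppose that for each $e\in[0,e_0)$ the function $\phi_{m,p}(\cdot,e):\mathbb R\to\mathbb R$ is a solution of $\ddot x+F(x,t,e)=0$ with $$\phi_{m,p}(0,e)=0,\qquad \dot\phi_{m,p}(0,e)=V(e),\qquad \phi_{m,p}(m\pi,e)=0 .$$ (This is the family of odd, $m\pi$-antiperiodic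 solutions that bifurcates from the odd periodic solution $\phi_{m,p}(t):=\phi_{m,p}(t,0)$ of $\ddot x+f(x)=0$.) For $e\in[0,e_0)$ let $\psi_1(\cdot,e),\psi_2(\cdot,e)$ be the solutions of $\ddot y+\frac{\partial F}{\partial x}(\phi_{m,p}(t,e),t,e)\,y=0$ with $(\psi_1,\dot\psi_1)(0,e)=(1,0)$ and $(\psi_2,\dot\psi_2)(0,e)=(0,1)$, and let $$\tau_{m,p}(e)=\psi_1(2m\pi,e)+\dot\psi_2(2m\pi,e)$$ be the trace of the $2m\pi$-Poincaré matrix. Then $\tau_{m,p}$ has a (right-hand) derivative at $e=0$, and $$\tau_{m,p}'(0)=-p\,T'(h_{m,p})\int_0^{2m\pi}F_{23}(t)\,\dot\phi_{m,p}(t)\,dt,\qquad F_{23}(t)=\frac{\partial^2F}{\partial t\,\partial e}(\phi_{m,p}(t),t,0).$$ -/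

import Mathlib

open Set Filter Topology MeasureTheory
open scoped ContDiff

/-- `F(x,t,e)` is smooth on `ℝ³`, odd in `x`, even and `2π`-periodic in `t`, and for `e = 0` it
reduces to an autonomous force `f` with `x f(x) > 0` for `x ≠ 0`. -/
structure IsSymmetricForce (F : ℝ → ℝ → ℝ → ℝ) (f : ℝ → ℝ) : Prop where
  smooth : ContDiff ℝ ∞ (fun z : ℝ × ℝ × ℝ => F z.1 z.2.1 z.2.2)
  odd_x : ∀ x t e, F (-x) t e = -F x t e
  even_t : ∀ x t e, F x (-t) e = F x t e
  periodic_t : ∀ x t e, F x (t + 2 * Real.pi) e = F x t e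
  autonomous : ∀ x t, F x t 0 = f x
  sign : ∀ x, x ≠ 0 → 0 < x * f x

/-- `x : ℝ → ℝ` is a (twice differentiable, globally defined) solution of `ẍ + G(x,t) = 0`. -/
def SolvesNewton (G : ℝ → ℝ → ℝ) (x : ℝ → ℝ) : Prop :=
  Differentiable ℝ x ∧ ∀ t, HasDerivAt (deriv x) (-G (x t) t) t

/-- The potential `∫₀ˣ f(u) du`. -/
noncomputable def potential (f : ℝ → ℝ) (x : ℝ) : ℝ := ∫ u in (0 : ℝ)..x, f u

/-- The minimal period `T(h)` of the orbit `½ẋ² + ∫₀ˣ f = h` of `ẍ + f(x) = 0`: the infimum of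
the positive periods of the solutions lying on this energy level. For
`0 < h < sup (potential f)` the level is one nonconstant closed orbit and the infimum is
attained. -/
noncomputable def periodFunction (f : ℝ → ℝ) (h : ℝ) : ℝ :=
  sInf {T : ℝ | 0 < T ∧ ∃ x : ℝ → ℝ, SolvesNewton (fun y _ => f y) x ∧
    (∀ t, (deriv x t) ^ 2 / 2 + potential f (x t) = h) ∧ Function.Periodic x T}

/-- A continuous branch, `0 ≤ e < e₀`, of solutions `φ e` of `ẍ + F(x,t,e) = 0` with
`φ e 0 = 0`, initial velocity `V e`, and `φ e (mπ) = 0`, which starts at `V 0 = η`. In view of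
the symmetries of `F` such solutions are odd and `mπ`-antiperiodic. -/
structure IsOddBranch (F : ℝ → ℝ → ℝ → ℝ) (m : ℕ) (η e₀ : ℝ) (V : ℝ → ℝ) (φ : ℝ → ℝ → ℝ) :
    Prop where
  pos : 0 < e₀
  continuousOn : ContinuousOn V (Ico 0 e₀)
  start : V 0 = η
  solves : ∀ e ∈ Ico 0 e₀, SolvesNewton (fun x t => F x t e) (φ e)
  initial_position : ∀ e ∈ Ico 0 e₀, φ e 0 = 0
  initial_velocity : ∀ e ∈ Ico 0 e₀, deriv (φ e) 0 = V e
  endpoint : ∀ e ∈ Ico 0 e₀, φ e (m * Real.pi) = 0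

/-- `ψ₁, ψ₂` are the fundamental solutions of Hill's equation `ÿ + q(t) y = 0`. -/
structure IsFundamentalPair (q ψ₁ ψ₂ : ℝ → ℝ) : Prop where
  solves₁ : SolvesNewton (fun y t => q t * y) ψ₁
  solves₂ : SolvesNewton (fun y t => q t * y) ψ₂
  position₁ : ψ₁ 0 = 1
  velocity₁ : deriv ψ₁ 0 = 0
  position₂ : ψ₂ 0 = 0
  velocity₂ : deriv ψ₂ 0 = 1

/-- The potential `q(t) = ∂F/∂x (x(t),t,e)` of the linearization of `ẍ + F(x,t,e) = 0` along
`x`. -/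
noncomputable def linearization (F : ℝ → ℝ → ℝ → ℝ) (e : ℝ) (x : ℝ → ℝ) (t : ℝ) : ℝ :=
  deriv (fun y => F y t e) (x t)

/-- The mixed partial derivative `∂²F/∂t∂e (x,t,e)`. -/
noncomputable def mixedPartial (F : ℝ → ℝ → ℝ → ℝ) (x t e : ℝ) : ℝ :=
  deriv (fun s => deriv (fun a => F x s a) e) t

/-- The trace of the `T`-Poincaré matrix of Hill's equation with fundamental solutions
`ψ₁, ψ₂`. -/
noncomputable def poincareTrace (ψ₁ ψ₂ : ℝ → ℝ) (T : ℝ) : ℝ :=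
  Matrix.trace !![ψ₁ T, ψ₂ T; deriv ψ₁ T, deriv ψ₂ T]

/-! Write S = 2mπ, x₀ = φ(·,0), η = ẋ₀(0), and let q_e be the linearized potential along φ(·,e). At
e = 0 the velocity ẋ₀ solves Hill's equation, so ẋ₀ = ηψ₁ and the Poincaré matrix is [[1, b], [0,
1]] with b = ψ₂(S) (`fundamental_endpoint`). The solution from the origin with velocity √(2k)
vanishes at time pT(k); differentiating this relation at k = h gives b = -pη²T'(h)
(`fundamental_endpoint_eq`).

For a matrix of this form the first variation of the trace is -b∫(q_e - q₀)ψ₁² = pT'(h)∫(q_e -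
q₀)ẋ₀², up to a quadratic error (`exists_trace_variation`). An integration by parts whose boundary
terms vanish turns the last integral into -e∫F₂₃ẋ₀ + O(e²) (`exists_integral_potential_variation`),
which yields the formula.

The branch is only assumed continuous. Since b ≠ 0, an endpoint estimate upgrades this to φ(t,e) -
φ(t,0) = O(e) (`exists_branch_bound`), which suffices: differentiability of φ in e is never needed.
All comparisons of solutions rest on one Gronwall estimate and on Wronskian identities, with
explicit remainders in place of smooth dependence of flows. -/

/-! ### Gronwall estimate and uniqueness. -/

/-- A Gronwall estimate for second order equations, in which the bound on `u''` is only required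
where `|u| ≤ 1`. -/
theorem gronwall_second_order {u u' u'' : ℝ → ℝ} {K ε δ S : ℝ} (hK : 0 ≤ K) (hε : 0 ≤ ε)
    (hδ : 0 ≤ δ) (hu : ∀ t, HasDerivAt u (u' t) t) (hu' : ∀ t, HasDerivAt u' (u'' t) t)
    (h0 : |u 0| ≤ δ) (h0' : |u' 0| ≤ δ) (hsmall : (δ + ε) * Real.exp ((K + 2) * S) < 1)
    (hbound : ∀ t ∈ Icc 0 S, |u t| ≤ 1 → |u'' t| ≤ K * |u t| + ε) :
    ∀ t ∈ Icc 0 S, |u t| ≤ (δ + ε) * Real.exp ((K + 2) * S) ∧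
      |u' t| ≤ (δ + ε) * Real.exp ((K + 2) * S) := by
  intro t ht
  -- The slack s makes the barrier strict: where the sup norm N of (u, u') meets it, N > ε, so both
  -- |u'| and K|u| + ε are below (K + 2)N. Keeping the barrier at most 1 is what makes `hbound`
  -- available there.
  have key : ∀ s : ℝ, 0 < s → (δ + ε + s) * Real.exp ((K + 2) * S) ≤ 1 →
      ‖(u t, u' t)‖ ≤ (δ + ε + s) * Real.exp ((K + 2) * t) := by
    intro s hs hs1
    have hB : ∀ x, HasDerivAt (fun x => (δ + ε + s) * Real.exp ((K + 2) * x))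
        ((K + 2) * ((δ + ε + s) * Real.exp ((K + 2) * x))) x := by
      intro x
      refine ((((hasDerivAt_id x).const_mul (K + 2)).exp).const_mul (δ + ε + s)).congr_deriv ?_
      simp only [id]; ring
    refine image_norm_le_of_norm_deriv_right_lt_deriv_boundary (a := 0) (b := S)
      (f := fun x => (u x, u' x)) (f' := fun x => (u' x, u'' x))
      (fun x _ => ((hu x).continuousAt.prodMk (hu' x).continuousAt).continuousWithinAt)
      (fun x _ => ((hu x).prodMk (hu' x)).hasDerivWithinAt) ?_ hB ?_ ht
    · simp only [mul_zero, Real.exp_zero, mul_one, Prod.norm_def, Real.norm_eq_abs]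
      exact max_le (by linarith) (by linarith)
    · intro x hx hxe
      have hle : (δ + ε + s) * Real.exp ((K + 2) * x) ≤ 1 := by
        refine le_trans ?_ hs1
        gcongr
        exact hx.2.le
      have hge : (δ + ε + s) ≤ (δ + ε + s) * Real.exp ((K + 2) * x) := by
        have : 1 ≤ Real.exp ((K + 2) * x) :=
          Real.one_le_exp (mul_nonneg (by linarith) hx.1)
        nlinarith
      rw [← hxe] at hle hge ⊢
      have h1 : |u x| ≤ ‖(u x, u' x)‖ := norm_fst_le (u x, u' x)
      have h2 : |u' x| ≤ ‖(u x, u' x)‖ := norm_snd_le (u x, u' x)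
      have h3 := hbound x ⟨hx.1, hx.2.le⟩ (h1.trans hle)
      have h4 : K * |u x| ≤ K * ‖(u x, u' x)‖ := mul_le_mul_of_nonneg_left h1 hK
      rw [Prod.norm_def (u' x, u'' x)]
      have h5 : 0 ≤ K * ‖(u x, u' x)‖ := by positivity
      refine max_lt ?_ ?_ <;> simp only [Real.norm_eq_abs] <;> nlinarith
  have hle : ‖(u t, u' t)‖ ≤ (δ + ε) * Real.exp ((K + 2) * S) := by
    set E := Real.exp ((K + 2) * S) with hE
    have hEpos : 0 < E := Real.exp_pos _
    refine le_of_forall_pos_le_add fun r hr => ?_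
    -- The first entry makes the slack cost at most r; the second keeps the barrier below 1.
    set s := min (r / E) ((1 - (δ + ε) * E) / E) with hsdef
    have hs : 0 < s := lt_min (by positivity) (div_pos (by linarith) hEpos)
    have hsr : s * E ≤ r := by
      have := min_le_left (r / E) ((1 - (δ + ε) * E) / E)
      rwa [← hsdef, le_div_iff₀ hEpos] at this
    have hs1 : s * E ≤ 1 - (δ + ε) * E := by
      have := min_le_right (r / E) ((1 - (δ + ε) * E) / E)
      rwa [← hsdef, le_div_iff₀ hEpos] at this
    have h1 := key s hs (by nlinarith)
    have h2 : Real.exp ((K + 2) * t) ≤ E := by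
      rw [hE]; gcongr; exact ht.2
    have h3 : (δ + ε + s) * Real.exp ((K + 2) * t) ≤ (δ + ε + s) * E :=
      mul_le_mul_of_nonneg_left h2 (by linarith)
    nlinarith
  exact ⟨(norm_fst_le (u t, u' t)).trans hle, (norm_snd_le (u t, u' t)).trans hle⟩

theorem SolvesNewton.hasDerivAt {G : ℝ → ℝ → ℝ} {x : ℝ → ℝ} (hx : SolvesNewton G x) (t : ℝ) :
    HasDerivAt x (deriv x t) t :=
  (hx.1 t).hasDerivAt

theorem SolvesNewton.continuous {G : ℝ → ℝ → ℝ} {x : ℝ → ℝ} (hx : SolvesNewton G x) :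
    Continuous x :=
  hx.1.continuous

theorem SolvesNewton.continuous_deriv {G : ℝ → ℝ → ℝ} {x : ℝ → ℝ} (hx : SolvesNewton G x) :
    Continuous (deriv x) :=
  continuous_iff_continuousAt.2 fun t => (hx.2 t).continuousAt

theorem SolvesNewton.of_hasDerivAt {G : ℝ → ℝ → ℝ} {x x' : ℝ → ℝ}
    (hx : ∀ t, HasDerivAt x (x' t) t) (hx' : ∀ t, HasDerivAt x' (-G (x t) t) t) :
    SolvesNewton G x := by
  have : deriv x = x' := funext fun t => (hx t).deriv
  exact ⟨fun t => (hx t).differentiableAt, by rwa [this]⟩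

/-- Continuous functions are bounded on `[0, S]`. -/
theorem exists_abs_le_on_Icc {g : ℝ → ℝ} (hg : Continuous g) (S : ℝ) :
    ∃ R, 0 ≤ R ∧ ∀ t ∈ Icc 0 S, |g t| ≤ R := by
  obtain ⟨C, hC⟩ := isCompact_Icc.exists_bound_of_continuousOn (s := Icc 0 S) hg.continuousOn
  exact ⟨max C 0, le_max_right _ _, fun t ht => (hC t ht).trans (le_max_left _ _)⟩

/-- Forward uniqueness for `ẍ + G(x,t) = 0` with `G` locally Lipschitz in `x`. -/
theorem SolvesNewton.eq_of_initial_eq {G : ℝ → ℝ → ℝ} {x y : ℝ → ℝ} (hx : SolvesNewton G x)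
    (hy : SolvesNewton G y)
    (hG : ∀ R : ℝ, ∃ K, ∀ a b t, |a| ≤ R → |b| ≤ R → |t| ≤ R → |G a t - G b t| ≤ K * |a - b|)
    (h0 : x 0 = y 0) (h0' : deriv x 0 = deriv y 0) {t : ℝ} (ht : 0 ≤ t) :
    x t = y t ∧ deriv x t = deriv y t := by
  obtain ⟨R₁, hR₁, hx₁⟩ := exists_abs_le_on_Icc hx.continuous t
  obtain ⟨R₂, hR₂, hy₂⟩ := exists_abs_le_on_Icc hy.continuous t
  obtain ⟨K, hK⟩ := hG (R₁ + R₂ + t)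
  -- With δ = ε = 0 the smallness condition is 0 < 1 and the resulting bound is zero.
  have := gronwall_second_order (u := fun s => x s - y s) (u' := fun s => deriv x s - deriv y s)
    (u'' := fun s => -G (x s) s - -G (y s) s) (K := |K|) (ε := 0) (δ := 0) (S := t)
    (abs_nonneg _) le_rfl le_rfl (fun s => (hx.hasDerivAt s).sub (hy.hasDerivAt s))
    (fun s => (hx.2 s).sub (hy.2 s)) (by simp [h0]) (by simp [h0']) (by simp) (by
      intro s hs _
      have h1 := hK (x s) (y s) s (by linarith [hx₁ s hs]) (by linarith [hy₂ s hs])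
        (by rw [abs_of_nonneg hs.1]; linarith [hs.2])
      have h2 : K * |x s - y s| ≤ |K| * |x s - y s| :=
        mul_le_mul_of_nonneg_right (le_abs_self K) (abs_nonneg _)
      rw [show -G (x s) s - -G (y s) s = -(G (x s) s - G (y s) s) by ring, abs_neg]
      linarith) t ⟨ht, le_rfl⟩
  simp only [add_zero, zero_mul] at this
  exact ⟨sub_eq_zero.1 (abs_nonpos_iff.1 this.1), sub_eq_zero.1 (abs_nonpos_iff.1 this.2)⟩

/-! ### Uniform Taylor bounds, partial derivatives and dependence on parameters. -/

theorem ContDiff.exists_norm_sub_le_on_closedBall {E E' : Type*} [NormedAddCommGroup E]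
    [NormedSpace ℝ E] [ProperSpace E] [NormedAddCommGroup E'] [NormedSpace ℝ E'] {g : E → E'}
    (hg : ContDiff ℝ 1 g) (R : ℝ) :
    ∃ C, 0 ≤ C ∧ ∀ z ∈ Metric.closedBall (0 : E) R, ∀ w ∈ Metric.closedBall (0 : E) R,
      ‖g w - g z‖ ≤ C * ‖w - z‖ := by
  obtain ⟨C, hC⟩ := (isCompact_closedBall (0 : E) R).exists_bound_of_continuousOn
    (hg.continuous_fderiv one_ne_zero).continuousOn
  refine ⟨max C 0, le_max_right _ _, fun z hz w hw => ?_⟩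
  exact (convex_closedBall (0 : E) R).norm_image_sub_le_of_norm_fderiv_le
    (fun x _ => hg.differentiable one_ne_zero x) (fun x hx => (hC x hx).trans (le_max_left _ _))
    hz hw

/-- On the segment from z to w the derivative differs from its value at z by at most C‖w - z‖; the
mean value inequality for g minus its linear part supplies the second factor. -/
theorem ContDiff.exists_norm_sub_fderiv_le_on_closedBall {E E' : Type*} [NormedAddCommGroup E]
    [NormedSpace ℝ E] [ProperSpace E] [NormedAddCommGroup E'] [NormedSpace ℝ E'] {g : E → E'}
    (hg : ContDiff ℝ 2 g) (R : ℝ) :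
    ∃ C, 0 ≤ C ∧ ∀ z ∈ Metric.closedBall (0 : E) R, ∀ w ∈ Metric.closedBall (0 : E) R,
      ‖g w - g z - fderiv ℝ g z (w - z)‖ ≤ C * ‖w - z‖ ^ 2 := by
  obtain ⟨C, hC0, hC⟩ := ContDiff.exists_norm_sub_le_on_closedBall
    (hg.fderiv_right (m := 1) (by norm_num)) R
  refine ⟨C, hC0, fun z hz w hw => ?_⟩
  have hsub : segment ℝ z w ⊆ Metric.closedBall (0 : E) R :=
    (convex_closedBall (0 : E) R).segment_subset hz hw
  have := (convex_segment z w).norm_image_sub_le_of_norm_fderiv_le' (f := g)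
    (φ := fderiv ℝ g z) (C := C * ‖w - z‖)
    (fun x _ => hg.differentiable two_ne_zero x) (fun x hx => ?_)
    (left_mem_segment ℝ z w) (right_mem_segment ℝ z w)
  · rw [pow_two, ← mul_assoc]; exact this
  · refine (hC z hz x (hsub hx)).trans (mul_le_mul_of_nonneg_left ?_ hC0)
    obtain ⟨a, ha, rfl⟩ := (segment_eq_image' ℝ z w ▸ hx : x ∈ (fun θ : ℝ => z + θ • (w - z)) '' Icc 0 1)
    rw [add_sub_cancel_left, norm_smul, Real.norm_eq_abs, abs_of_nonneg ha.1]
    exact mul_le_of_le_one_left (norm_nonneg _) ha.2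

/-- The partial derivative with respect to the first variable. -/
noncomputable def partialX (G : ℝ × ℝ × ℝ → ℝ) (z : ℝ × ℝ × ℝ) : ℝ := fderiv ℝ G z (1, 0, 0)

/-- The partial derivative with respect to the second variable. -/
noncomputable def partialT (G : ℝ × ℝ × ℝ → ℝ) (z : ℝ × ℝ × ℝ) : ℝ := fderiv ℝ G z (0, 1, 0)

/-- The partial derivative with respect to the third variable. -/
noncomputable def partialE (G : ℝ × ℝ × ℝ → ℝ) (z : ℝ × ℝ × ℝ) : ℝ := fderiv ℝ G z (0, 0, 1)

theorem two_le_infty : (2 : WithTop ℕ∞) ≤ ∞ :=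
  WithTop.coe_le_coe.2 (le_top : (2 : ℕ∞) ≤ ⊤)

section Partial

variable {G : ℝ × ℝ × ℝ → ℝ}

theorem contDiff_fderiv_apply_const (hG : ContDiff ℝ ∞ G) (v : ℝ × ℝ × ℝ) :
    ContDiff ℝ ∞ (fun z => fderiv ℝ G z v) :=
  (hG.fderiv_right (m := ∞) (by norm_num)).clm_apply contDiff_const

theorem contDiff_partialX (hG : ContDiff ℝ ∞ G) : ContDiff ℝ ∞ (partialX G) :=
  contDiff_fderiv_apply_const hG _

theorem contDiff_partialT (hG : ContDiff ℝ ∞ G) : ContDiff ℝ ∞ (partialT G) :=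
  contDiff_fderiv_apply_const hG _

theorem contDiff_partialE (hG : ContDiff ℝ ∞ G) : ContDiff ℝ ∞ (partialE G) :=
  contDiff_fderiv_apply_const hG _

theorem fderiv_apply_eq_partial (z : ℝ × ℝ × ℝ) (a b c : ℝ) :
    fderiv ℝ G z (a, b, c) = partialX G z * a + partialT G z * b + partialE G z * c := by
  have : ((a, b, c) : ℝ × ℝ × ℝ) = a • (1, 0, 0) + b • (0, 1, 0) + c • (0, 0, 1) := by simp
  rw [this, map_add, map_add, map_smul, map_smul, map_smul, partialX, partialT, partialE]
  simp only [smul_eq_mul]; ring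

theorem hasDerivAt_comp_curve (hG : ContDiff ℝ ∞ G) {a b c : ℝ → ℝ} {a' b' c' t : ℝ}
    (ha : HasDerivAt a a' t) (hb : HasDerivAt b b' t) (hc : HasDerivAt c c' t) :
    HasDerivAt (fun s => G (a s, b s, c s))
      (partialX G (a t, b t, c t) * a' + partialT G (a t, b t, c t) * b' +
        partialE G (a t, b t, c t) * c') t := by
  rw [← fderiv_apply_eq_partial]
  exact ((hG.differentiable (by simp)) (a t, b t, c t)).hasFDerivAt.comp_hasDerivAt t
    (ha.prodMk (hb.prodMk hc))

theorem deriv_fst_eq_partialX (hG : ContDiff ℝ ∞ G) (x t e : ℝ) :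
    deriv (fun y => G (y, t, e)) x = partialX G (x, t, e) := by
  simpa using (hasDerivAt_comp_curve hG (hasDerivAt_id x) (hasDerivAt_const x t)
    (hasDerivAt_const x e)).deriv

theorem deriv_snd_eq_partialT (hG : ContDiff ℝ ∞ G) (x t e : ℝ) :
    deriv (fun s => G (x, s, e)) t = partialT G (x, t, e) := by
  simpa using (hasDerivAt_comp_curve hG (hasDerivAt_const t x) (hasDerivAt_id t)
    (hasDerivAt_const t e)).deriv

theorem deriv_thd_eq_partialE (hG : ContDiff ℝ ∞ G) (x t e : ℝ) :
    deriv (fun a => G (x, t, a)) e = partialE G (x, t, e) := by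
  simpa using (hasDerivAt_comp_curve hG (hasDerivAt_const e x) (hasDerivAt_const e t)
    (hasDerivAt_id e)).deriv

/-- Needed because differentiating F_e along x₀ produces F_ex, whereas the Taylor expansion of F_x
produces F_xe. -/
theorem partialX_partialE_comm (hG : ContDiff ℝ ∞ G) (z : ℝ × ℝ × ℝ) :
    partialX (partialE G) z = partialE (partialX G) z := by
  have hd : DifferentiableAt ℝ (fderiv ℝ G) z :=
    (hG.fderiv_right (m := ∞) (by norm_num)).differentiable (by simp) z
  have hsymm : IsSymmSndFDerivAt ℝ G z :=
    hG.contDiffAt.isSymmSndFDerivAt (by simpa using two_le_infty)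
  have key : ∀ v w : ℝ × ℝ × ℝ,
      fderiv ℝ (fun z => fderiv ℝ G z v) z w = fderiv ℝ (fderiv ℝ G) z w v := by
    intro v w
    rw [fderiv_clm_apply hd (differentiableAt_const v)]
    simp
  change fderiv ℝ (fun z => fderiv ℝ G z (0, 0, 1)) z (1, 0, 0) =
    fderiv ℝ (fun z => fderiv ℝ G z (1, 0, 0)) z (0, 0, 1)
  rw [key, key, hsymm.eq]

theorem mem_closedBall_triple {x t e R : ℝ} (hx : |x| ≤ R) (ht : |t| ≤ R) (he : |e| ≤ R) :
    ((x, t, e) : ℝ × ℝ × ℝ) ∈ Metric.closedBall (0 : ℝ × ℝ × ℝ) R := by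
  rw [mem_closedBall_zero_iff]
  exact max_le hx (max_le ht he)

theorem norm_triple_sub_le (x y t e : ℝ) :
    ‖((y, t, e) : ℝ × ℝ × ℝ) - (x, t, 0)‖ ≤ |y - x| + |e| := by
  have h1 := abs_nonneg (y - x)
  have h2 := abs_nonneg e
  simp only [Prod.mk_sub_mk, sub_self, sub_zero, Prod.norm_def, Real.norm_eq_abs, abs_zero]
  exact max_le (by linarith) (max_le (by linarith) (by linarith))

theorem exists_abs_sub_le (hG : ContDiff ℝ ∞ G) (R : ℝ) :
    ∃ C, 0 ≤ C ∧ ∀ x y t e : ℝ, |x| ≤ R → |y| ≤ R → |t| ≤ R → |e| ≤ R →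
      |G (y, t, e) - G (x, t, 0)| ≤ C * (|y - x| + |e|) := by
  obtain ⟨C, hC0, hC⟩ := ContDiff.exists_norm_sub_le_on_closedBall (hG.of_le (by simp)) R
  refine ⟨C, hC0, fun x y t e hx hy ht he => ?_⟩
  have hR : |(0 : ℝ)| ≤ R := by simpa using (abs_nonneg x).trans hx
  refine (hC (x, t, 0) (mem_closedBall_triple hx ht hR) (y, t, e)
    (mem_closedBall_triple hy ht he)).trans ?_
  exact mul_le_mul_of_nonneg_left (norm_triple_sub_le x y t e) hC0

theorem exists_abs_sub_fst_le (hG : ContDiff ℝ ∞ G) (R : ℝ) :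
    ∃ C, 0 ≤ C ∧ ∀ x y t e : ℝ, |x| ≤ R → |y| ≤ R → |t| ≤ R → |e| ≤ R →
      |G (y, t, e) - G (x, t, e)| ≤ C * |y - x| := by
  obtain ⟨C, hC0, hC⟩ := ContDiff.exists_norm_sub_le_on_closedBall (hG.of_le (by simp)) R
  refine ⟨C, hC0, fun x y t e hx hy ht he => ?_⟩
  refine (hC (x, t, e) (mem_closedBall_triple hx ht he) (y, t, e)
    (mem_closedBall_triple hy ht he)).trans ?_
  simp [Prod.norm_def]

theorem exists_abs_taylor_le (hG : ContDiff ℝ ∞ G) (R : ℝ) :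
    ∃ C, 0 ≤ C ∧ ∀ x y t e : ℝ, |x| ≤ R → |y| ≤ R → |t| ≤ R → |e| ≤ R →
      |G (y, t, e) - G (x, t, 0) - (partialX G (x, t, 0) * (y - x) + partialE G (x, t, 0) * e)| ≤
        C * (|y - x| + |e|) ^ 2 := by
  obtain ⟨C, hC0, hC⟩ := ContDiff.exists_norm_sub_fderiv_le_on_closedBall
    (hG.of_le two_le_infty) R
  refine ⟨C, hC0, fun x y t e hx hy ht he => ?_⟩
  have hR : |(0 : ℝ)| ≤ R := by simpa using (abs_nonneg x).trans hx
  have h1 := hC (x, t, 0) (mem_closedBall_triple hx ht hR) (y, t, e)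
    (mem_closedBall_triple hy ht he)
  have h2 : fderiv ℝ G (x, t, 0) ((y, t, e) - (x, t, 0)) =
      partialX G (x, t, 0) * (y - x) + partialE G (x, t, 0) * e := by
    simp [fderiv_apply_eq_partial]
  rw [h2] at h1
  refine h1.trans (mul_le_mul_of_nonneg_left ?_ hC0)
  exact pow_le_pow_left₀ (norm_nonneg _) (norm_triple_sub_le x y t e) 2

/-- Lipschitz dependence of solutions on the parameter `e` and on the initial velocity. -/
theorem exists_newton_stability (hG : ContDiff ℝ ∞ G) {x₀ : ℝ → ℝ}
    (hx₀ : SolvesNewton (fun x t => G (x, t, 0)) x₀) {S : ℝ} (hS : 0 ≤ S) :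
    ∃ C r, 0 ≤ C ∧ 0 < r ∧ r ≤ 1 ∧ ∀ (e : ℝ) (x : ℝ → ℝ), |e| ≤ r →
      |deriv x 0 - deriv x₀ 0| ≤ r → SolvesNewton (fun x t => G (x, t, e)) x → x 0 = x₀ 0 →
      ∀ t ∈ Icc 0 S, |x t - x₀ t| ≤ C * (|e| + |deriv x 0 - deriv x₀ 0|) ∧
        |deriv x t - deriv x₀ t| ≤ C * (|e| + |deriv x 0 - deriv x₀ 0|) ∧
        |x t - x₀ t| ≤ 1 := by
  obtain ⟨R, hR0, hR⟩ := exists_abs_le_on_Icc hx₀.continuous S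
  -- This radius covers x₀, every x within distance 1 of it, times in [0, S] and |e| ≤ 1.
  obtain ⟨K, hK0, hK⟩ := exists_abs_sub_le hG (R + S + 1)
  set E := Real.exp ((K + 2) * S)
  have hE : 0 < E := Real.exp_pos _
  set C := (1 + K) * E with hCdef
  have hC : 0 ≤ C := by positivity
  -- With both perturbations at most r = 1/(2C + 1), the final bound is at most 2C/(2C + 1) < 1, as
  -- the Gronwall estimate requires.
  refine ⟨C, 1 / (2 * C + 1), hC, by positivity, ?_, ?_⟩
  · rw [div_le_one (by positivity)]; linarith
  intro e x he hv hx h0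
  have he1 : |e| ≤ 1 := he.trans (by rw [div_le_one (by positivity)]; linarith)
  have hle : (|deriv x 0 - deriv x₀ 0| + K * |e|) * E ≤ C * (|e| + |deriv x 0 - deriv x₀ 0|) := by
    have h1 : |deriv x 0 - deriv x₀ 0| + K * |e| ≤ (1 + K) * (|e| + |deriv x 0 - deriv x₀ 0|) := by
      have := abs_nonneg e
      have := mul_nonneg hK0 (abs_nonneg (deriv x 0 - deriv x₀ 0))
      linarith
    calc _ ≤ ((1 + K) * (|e| + |deriv x 0 - deriv x₀ 0|)) * E :=
          mul_le_mul_of_nonneg_right h1 hE.le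
      _ = _ := by rw [hCdef]; ring
  have hlt : C * (|e| + |deriv x 0 - deriv x₀ 0|) < 1 := by
    calc C * (|e| + |deriv x 0 - deriv x₀ 0|) ≤ C * (1 / (2 * C + 1) + 1 / (2 * C + 1)) := by gcongr
      _ < 1 := by
        rw [← add_div, mul_div_assoc', div_lt_one (by positivity)]; linarith
  have := gronwall_second_order (u := fun s => x s - x₀ s)
    (u' := fun s => deriv x s - deriv x₀ s)
    (u'' := fun s => -G (x s, s, e) - -G (x₀ s, s, 0)) (K := K) (ε := K * |e|)
    (δ := |deriv x 0 - deriv x₀ 0|) (S := S) hK0 (by positivity) (abs_nonneg _)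
    (fun s => (hx.hasDerivAt s).sub (hx₀.hasDerivAt s))
    (fun s => (hx.2 s).sub (hx₀.2 s)) (by simp [h0]) le_rfl (hle.trans_lt hlt) (by
      intro s hs hs1
      have h1 := hR s hs
      have h2 : |x s| ≤ R + 1 := by
        calc |x s| = |(x s - x₀ s) + x₀ s| := by ring_nf
          _ ≤ |x s - x₀ s| + |x₀ s| := abs_add_le _ _
          _ ≤ _ := by linarith
      have h3 := hK (x₀ s) (x s) s e (by linarith) (by linarith)
        (by rw [abs_of_nonneg hs.1]; linarith [hs.2]) (by linarith)
      rw [show -G (x s, s, e) - -G (x₀ s, s, 0) = -(G (x s, s, e) - G (x₀ s, s, 0)) by ring,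
        abs_neg]
      linarith)
  intro t ht
  obtain ⟨h1, h2⟩ := this t ht
  exact ⟨h1.trans hle, h2.trans hle, (h1.trans hle).trans hlt.le⟩

end Partial

/-! ### Symmetries of the force and zeros of unperturbed solutions. -/

namespace IsSymmetricForce

variable {F : ℝ → ℝ → ℝ → ℝ} {f : ℝ → ℝ}

theorem force_neg (hF : IsSymmetricForce F f) (x : ℝ) : f (-x) = -f x := by
  rw [← hF.autonomous (-x) 0, hF.odd_x, hF.autonomous]

theorem map_zero (hF : IsSymmetricForce F f) (t e : ℝ) : F 0 t e = 0 := by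
  have := hF.odd_x 0 t e
  rw [neg_zero] at this
  linarith

theorem force_zero (hF : IsSymmetricForce F f) : f 0 = 0 := by
  rw [← hF.autonomous 0 0, hF.map_zero]

theorem eq_zero_of_force_eq_zero (hF : IsSymmetricForce F f) {x : ℝ} (hx : f x = 0) : x = 0 := by
  by_contra hne
  have := hF.sign x hne
  simp [hx] at this

theorem solvesNewton_zero_iff (hF : IsSymmetricForce F f) {x : ℝ → ℝ} :
    SolvesNewton (fun x t => F x t 0) x ↔ SolvesNewton (fun x _ => f x) x := by
  have : (fun x t => F x t 0) = fun x (_ : ℝ) => f x := by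
    funext x t; exact hF.autonomous x t
  rw [this]

/-- Reflection about mπ is reflection about 0 followed by a translation by m periods. -/
theorem map_reflect (hF : IsSymmetricForce F f) (m : ℕ) (x t e : ℝ) :
    F x (m * Real.pi - t) e = F x (m * Real.pi + t) e := by
  have hper : Function.Periodic (fun t => F x t e) (m * (2 * Real.pi)) :=
    Function.Periodic.nat_mul (fun t => hF.periodic_t x t e) m
  have h1 := hper (t - m * Real.pi)
  simp only at h1
  rw [show t - m * Real.pi + m * (2 * Real.pi) = m * Real.pi + t by ring,
    show t - m * Real.pi = -(m * Real.pi - t) by ring, hF.even_t] at h1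
  exact h1.symm

theorem exists_lipschitz (hF : IsSymmetricForce F f) (e R : ℝ) :
    ∃ K, ∀ a b t, |a| ≤ R → |b| ≤ R → |t| ≤ R → |F a t e - F b t e| ≤ K * |a - b| := by
  obtain ⟨K, -, hK⟩ := exists_abs_sub_fst_le hF.smooth (R + |e|)
  have := abs_nonneg e
  exact ⟨K, fun a b t ha hb ht =>
    hK b a t e (by linarith) (by linarith) (by linarith) (by linarith [abs_nonneg a])⟩

/-- A solution which vanishes at `0` and at `mπ` is odd about `mπ`. -/
theorem reflect_solution (hF : IsSymmetricForce F f) {e : ℝ} {x : ℝ → ℝ}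
    (hx : SolvesNewton (fun x t => F x t e) x) {m : ℕ} (h0 : x 0 = 0)
    (hm : x (m * Real.pi) = 0) :
    x (2 * m * Real.pi) = 0 ∧ deriv x (2 * m * Real.pi) = deriv x 0 := by
  set L : ℝ := m * Real.pi with hL
  have hL0 : 0 ≤ L := by positivity
  have du : ∀ s, HasDerivAt (fun s => x (L + s)) (deriv x (L + s)) s := fun s =>
    (hx.hasDerivAt (L + s)).comp_const_add L s
  have du' : ∀ s, HasDerivAt (fun s => deriv x (L + s)) (-F (x (L + s)) (L + s) e) s := fun s =>
    (hx.2 (L + s)).comp_const_add L s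
  -- By oddness in x and evenness about L = mπ, -x(L - s) solves the same equation as x(L + s), with
  -- the same data at s = 0. Uniqueness is then applied at s = L.
  have dv : ∀ s, HasDerivAt (fun s => -x (L - s)) (deriv x (L - s)) s := fun s =>
    ((hx.hasDerivAt (L - s)).comp_const_sub L s).fun_neg.congr_deriv (neg_neg _)
  have dv' : ∀ s, HasDerivAt (fun s => deriv x (L - s)) (-F (-x (L - s)) (L + s) e) s := fun s => by
    refine ((hx.2 (L - s)).comp_const_sub L s).congr_deriv ?_
    change - -F (x (L - s)) (L - s) e = _
    rw [hF.odd_x, hL, hF.map_reflect]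
  have hu := SolvesNewton.of_hasDerivAt (G := fun x s => F x (L + s) e) du du'
  have hv := SolvesNewton.of_hasDerivAt (G := fun x s => F x (L + s) e) dv dv'
  have hlip : ∀ R : ℝ, ∃ K, ∀ a b t, |a| ≤ R → |b| ≤ R → |t| ≤ R →
      |F a (L + t) e - F b (L + t) e| ≤ K * |a - b| := by
    intro R
    obtain ⟨K, hK⟩ := hF.exists_lipschitz e (R + L)
    refine ⟨K, fun a b t ha hb ht => hK a b (L + t) (by linarith) (by linarith) ?_⟩
    rw [abs_le] at ht ⊢
    constructor <;> linarith
  obtain ⟨h1, h2⟩ := hu.eq_of_initial_eq hv hlip (by simp [hm])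
    (by rw [(du 0).deriv, (dv 0).deriv]; simp) hL0
  rw [(du L).deriv, (dv L).deriv] at h2
  rw [show 2 * (m : ℝ) * Real.pi = L + L by rw [hL]; ring, h1, h2]
  simp [h0]

/-- Rolle applied to the velocity over one period gives a zero of the force, hence a zero of x,
where the energy fixes the speed. Translating that time to 0 and, if needed, changing the sign
normalizes the solution. -/
theorem exists_periodic_solution (hF : IsSymmetricForce F f) {k T : ℝ}
    (hT : 0 < T) {x : ℝ → ℝ} (hx : SolvesNewton (fun y _ => f y) x)
    (hE : ∀ t, (deriv x t) ^ 2 / 2 + potential f (x t) = k) (hper : Function.Periodic x T) :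
    ∃ y : ℝ → ℝ, SolvesNewton (fun y _ => f y) y ∧ y 0 = 0 ∧ deriv y 0 = Real.sqrt (2 * k) ∧
      Function.Periodic y T := by
  have hper' : deriv x 0 = deriv x T := by
    have h1 : (fun t => x (t + T)) = x := funext hper
    have h2 := deriv_comp_add_const x T 0
    rw [h1, zero_add] at h2
    exact h2
  obtain ⟨c, -, hc⟩ := exists_hasDerivAt_eq_zero hT hx.continuous_deriv.continuousOn hper'
    (fun t _ => hx.2 t)
  have hxc : x c = 0 := hF.eq_zero_of_force_eq_zero (neg_eq_zero.1 hc)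
  have hv : deriv x c ^ 2 = 2 * k := by
    have := hE c
    rw [hxc, potential, intervalIntegral.integral_same] at this
    linarith
  have du : ∀ s, HasDerivAt (fun s => x (c + s)) (deriv x (c + s)) s := fun s =>
    (hx.hasDerivAt (c + s)).comp_const_add c s
  have du' : ∀ s, HasDerivAt (fun s => deriv x (c + s)) (-f (x (c + s))) s := fun s =>
    (hx.2 (c + s)).comp_const_add c s
  have hsh : Function.Periodic (fun s => x (c + s)) T := fun s => by
    simp only [← add_assoc]; exact hper _
  rcases le_total 0 (deriv x c) with h0 | h0
  · refine ⟨fun s => x (c + s), SolvesNewton.of_hasDerivAt du du', by simp [hxc], ?_, hsh⟩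
    rw [(du 0).deriv, ← hv, add_zero, Real.sqrt_sq h0]
  · refine ⟨fun s => -x (c + s), SolvesNewton.of_hasDerivAt (fun s => (du s).fun_neg) (fun s => ?_),
      by simp [hxc], ?_, fun s => congrArg Neg.neg (hsh s)⟩
    · exact (du' s).fun_neg.congr_deriv (by rw [hF.force_neg])
    · rw [(du 0).fun_neg.deriv, ← hv, add_zero,
        ← neg_sq, Real.sqrt_sq (neg_nonneg.2 h0)]

/-- On an energy level with positive period function, the solution starting at the origin vanishes
at all multiples of the period function. -/
theorem exists_solution_of_periodFunction_pos (hF : IsSymmetricForce F f) {k : ℝ}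
    (hT : 0 < periodFunction f k) :
    ∃ y : ℝ → ℝ, SolvesNewton (fun x t => F x t 0) y ∧ y 0 = 0 ∧
      deriv y 0 = Real.sqrt (2 * k) ∧ ∀ p : ℕ, y (p * periodFunction f k) = 0 := by
  rw [periodFunction] at hT ⊢
  set P := {T : ℝ | 0 < T ∧ ∃ x : ℝ → ℝ, SolvesNewton (fun y _ => f y) x ∧
    (∀ t, (deriv x t) ^ 2 / 2 + potential f (x t) = k) ∧ Function.Periodic x T}
  have hne : P.Nonempty := by
    -- The infimum of the empty set is 0, so a positive value already provides a periodic solution.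
    rw [nonempty_iff_ne_empty]
    intro h0
    rw [h0, Real.sInf_empty] at hT
    exact lt_irrefl _ hT
  obtain ⟨u, -, hu, huP⟩ := exists_seq_tendsto_sInf hne ⟨0, fun T hT => hT.1.le⟩
  have hsol : ∀ n, ∃ y : ℝ → ℝ, SolvesNewton (fun y _ => f y) y ∧ y 0 = 0 ∧
      deriv y 0 = Real.sqrt (2 * k) ∧ Function.Periodic y (u n) := by
    intro n
    obtain ⟨h0, x, hx, hE, hper⟩ := huP n
    exact hF.exists_periodic_solution h0 hx hE hper
  choose y hy hy0 hy1 hyp using hsol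
  refine ⟨y 0, hF.solvesNewton_zero_iff.2 (hy 0), hy0 0, hy1 0, fun p => ?_⟩
  have hlip : ∀ R : ℝ, ∃ K, ∀ a b t : ℝ, |a| ≤ R → |b| ≤ R → |t| ≤ R →
      |f a - f b| ≤ K * |a - b| := by
    intro R
    obtain ⟨K, hK⟩ := hF.exists_lipschitz 0 R
    exact ⟨K, fun a b t ha hb ht => by simpa only [hF.autonomous] using hK a b t ha hb ht⟩
  -- By uniqueness all the normalized solutions agree for positive time, so one solution vanishes at
  -- p times every u n; continuity passes to the infimum, which need not be attained.
  have hz : ∀ n, y 0 (p * u n) = 0 := by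
    intro n
    have hn : 0 ≤ p * u n := mul_nonneg p.cast_nonneg (huP n).1.le
    rw [((hy 0).eq_of_initial_eq (hy n) hlip (by rw [hy0, hy0]) (by rw [hy1, hy1]) hn).1]
    have := ((hyp n).nat_mul p) 0
    rwa [zero_add, hy0] at this
  have hlim : Tendsto (fun n => y 0 (p * u n)) atTop (𝓝 (y 0 (p * sInf P))) :=
    ((hy 0).continuous.tendsto _).comp (hu.const_mul _)
  simp only [hz] at hlim
  exact tendsto_nhds_unique hlim tendsto_const_nhds

end IsSymmetricForce

/-! ### Wronskians and Hill's equation. -/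

/-- The endpoint Wronskian of `u` with a solution of Hill's equation `ÿ + q(t) y = 0` changes
little if `u` nearly solves this equation. -/
theorem abs_wronskian_sub_le {q χ u u' u'' : ℝ → ℝ} {S ρ M : ℝ} (hS : 0 ≤ S)
    (hχ : SolvesNewton (fun y t => q t * y) χ) (hu : ∀ t, HasDerivAt u (u' t) t)
    (hu' : ∀ t, HasDerivAt u' (u'' t) t) (hρ : ∀ t ∈ Icc 0 S, |u'' t + q t * u t| ≤ ρ)
    (hM : ∀ t ∈ Icc 0 S, |χ t| ≤ M) :
    |(u' S * χ S - u S * deriv χ S) - (u' 0 * χ 0 - u 0 * deriv χ 0)| ≤ ρ * M * S := by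
  have hd : ∀ t, HasDerivAt (fun t => u' t * χ t - u t * deriv χ t)
      ((u'' t + q t * u t) * χ t) t := fun t =>
    (((hu' t).mul (hχ.hasDerivAt t)).sub ((hu t).mul (hχ.2 t))).congr_deriv (by ring)
  have hρ0 : 0 ≤ ρ := (abs_nonneg _).trans (hρ 0 ⟨le_rfl, hS⟩)
  have := (convex_Icc 0 S).norm_image_sub_le_of_norm_hasDerivWithin_le
    (f := fun t => u' t * χ t - u t * deriv χ t) (C := ρ * M)
    (fun t _ => (hd t).hasDerivWithinAt) (fun t ht => by
      rw [Real.norm_eq_abs, abs_mul]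
      exact mul_le_mul (hρ t ht) (hM t ht) (abs_nonneg _) hρ0)
    (left_mem_Icc.2 hS) (right_mem_Icc.2 hS)
  simpa [abs_of_nonneg hS] using this

theorem SolvesNewton.linear_combination {q y z : ℝ → ℝ}
    (hy : SolvesNewton (fun y t => q t * y) y) (hz : SolvesNewton (fun y t => q t * y) z)
    (a b : ℝ) :
    SolvesNewton (fun y t => q t * y) (fun t => a * y t + b * z t) ∧
      ∀ t, deriv (fun t => a * y t + b * z t) t = a * deriv y t + b * deriv z t := by
  have hd : ∀ t, HasDerivAt (fun t => a * y t + b * z t) (a * deriv y t + b * deriv z t) t :=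
    fun t => ((hy.hasDerivAt t).const_mul a).add ((hz.hasDerivAt t).const_mul b)
  refine ⟨SolvesNewton.of_hasDerivAt hd fun t => ?_, fun t => (hd t).deriv⟩
  exact (((hy.2 t).const_mul a).add ((hz.2 t).const_mul b)).congr_deriv (by ring)

/-- The Wronskian of the fundamental pair is `1`. -/
theorem IsFundamentalPair.wronskian_eq_one {q ψ₁ ψ₂ : ℝ → ℝ} (hψ : IsFundamentalPair q ψ₁ ψ₂)
    (t : ℝ) : ψ₁ t * deriv ψ₂ t - deriv ψ₁ t * ψ₂ t = 1 := by
  have hd : ∀ t, HasDerivAt (fun t => ψ₁ t * deriv ψ₂ t - deriv ψ₁ t * ψ₂ t) 0 t := fun t =>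
    (((hψ.solves₁.hasDerivAt t).mul (hψ.solves₂.2 t)).sub
      ((hψ.solves₁.2 t).mul (hψ.solves₂.hasDerivAt t))).congr_deriv (by ring)
  have := is_const_of_deriv_eq_zero (fun t => (hd t).differentiableAt) (fun t => (hd t).deriv) t 0
  simpa [hψ.position₁, hψ.velocity₁, hψ.position₂, hψ.velocity₂] using this

/-- `F` as a function on `ℝ × ℝ × ℝ`. -/
def uncurryForce (F : ℝ → ℝ → ℝ → ℝ) (z : ℝ × ℝ × ℝ) : ℝ := F z.1 z.2.1 z.2.2

/-! ### The unperturbed Poincaré matrix and the period function. -/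

namespace IsSymmetricForce

variable {F : ℝ → ℝ → ℝ → ℝ} {f : ℝ → ℝ}

theorem contDiff_uncurry (hF : IsSymmetricForce F f) : ContDiff ℝ ∞ (uncurryForce F) := hF.smooth

theorem linearization_eq (hF : IsSymmetricForce F f) (e : ℝ) (x : ℝ → ℝ) (t : ℝ) :
    linearization F e x t = partialX (uncurryForce F) (x t, t, e) :=
  deriv_fst_eq_partialX hF.contDiff_uncurry (x t) t e

theorem partialX_zero (hF : IsSymmetricForce F f) (x t : ℝ) :
    partialX (uncurryForce F) (x, t, 0) = deriv f x := by
  rw [← deriv_fst_eq_partialX hF.contDiff_uncurry]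
  congr 1
  funext y
  exact hF.autonomous y t

theorem partialT_zero (hF : IsSymmetricForce F f) (x t : ℝ) :
    partialT (uncurryForce F) (x, t, 0) = 0 := by
  rw [← deriv_snd_eq_partialT hF.contDiff_uncurry]
  have : (fun s => uncurryForce F (x, s, 0)) = fun _ => f x := funext fun s => hF.autonomous x s
  rw [this, deriv_const]

theorem partialT_partialX_zero (hF : IsSymmetricForce F f) (x t : ℝ) :
    partialT (partialX (uncurryForce F)) (x, t, 0) = 0 := by
  rw [← deriv_snd_eq_partialT (contDiff_partialX hF.contDiff_uncurry)]
  simp only [hF.partialX_zero, deriv_const]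

theorem partialE_origin (hF : IsSymmetricForce F f) (t : ℝ) :
    partialE (uncurryForce F) (0, t, 0) = 0 := by
  rw [← deriv_thd_eq_partialE hF.contDiff_uncurry]
  have : (fun a => uncurryForce F (0, t, a)) = fun _ => 0 := funext fun a => hF.map_zero t a
  rw [this, deriv_const]

theorem mixedPartial_eq (hF : IsSymmetricForce F f) (x t e : ℝ) :
    mixedPartial F x t e = partialT (partialE (uncurryForce F)) (x, t, e) := by
  rw [← deriv_snd_eq_partialT (contDiff_partialE hF.contDiff_uncurry)]
  simp only [← deriv_thd_eq_partialE hF.contDiff_uncurry]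
  rfl

theorem continuous_linearization (hF : IsSymmetricForce F f) (e : ℝ) {x : ℝ → ℝ}
    (hx : Continuous x) : Continuous (linearization F e x) := by
  rw [funext (hF.linearization_eq e x)]
  exact (contDiff_partialX hF.contDiff_uncurry).continuous.comp
    (hx.prodMk (continuous_id.prodMk continuous_const))

theorem hasDerivAt_force (hF : IsSymmetricForce F f) {x₀ : ℝ → ℝ}
    (hx₀ : SolvesNewton (fun x t => F x t 0) x₀) (t : ℝ) :
    HasDerivAt (fun t => f (x₀ t)) (linearization F 0 x₀ t * deriv x₀ t) t := by
  have h1 := hasDerivAt_comp_curve hF.contDiff_uncurry (hx₀.hasDerivAt t) (hasDerivAt_id t)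
    (hasDerivAt_const t 0)
  have h2 : (fun s => uncurryForce F (x₀ s, id s, 0)) = fun s => f (x₀ s) :=
    funext fun s => hF.autonomous (x₀ s) s
  rw [h2] at h1
  refine h1.congr_deriv ?_
  simp only [id, hF.partialT_zero, hF.linearization_eq]
  ring

/-- The velocity of an unperturbed solution solves the linearized equation. -/
theorem deriv_eq_mul_fundamental (hF : IsSymmetricForce F f) {x₀ ψ₁ ψ₂ : ℝ → ℝ}
    (hx₀ : SolvesNewton (fun x t => F x t 0) x₀) (h0 : x₀ 0 = 0)
    (hψ : IsFundamentalPair (linearization F 0 x₀) ψ₁ ψ₂) {t : ℝ} (ht : 0 ≤ t) :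
    deriv x₀ t = deriv x₀ 0 * ψ₁ t ∧ -f (x₀ t) = deriv x₀ 0 * deriv ψ₁ t := by
  have hd : ∀ s, HasDerivAt (deriv x₀) (-f (x₀ s)) s := fun s =>
    (hx₀.2 s).congr_deriv (congrArg Neg.neg (hF.autonomous _ s))
  have hd' : ∀ s, HasDerivAt (fun s => -f (x₀ s)) (-(linearization F 0 x₀ s * deriv x₀ s)) s :=
    fun s => (hF.hasDerivAt_force hx₀ s).fun_neg
  have hsol : SolvesNewton (fun y t => linearization F 0 x₀ t * y) (deriv x₀) :=
    SolvesNewton.of_hasDerivAt hd hd'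
  obtain ⟨hlin, hlin'⟩ := hψ.solves₁.linear_combination hψ.solves₂ (deriv x₀ 0) 0
  obtain ⟨h1, h2⟩ := hsol.eq_of_initial_eq hlin (fun R => by
    obtain ⟨K, hK⟩ := isCompact_Icc.exists_bound_of_continuousOn (s := Icc (-R) R)
      (hF.continuous_linearization 0 hx₀.continuous).continuousOn
    refine ⟨K, fun a b t _ _ ht => ?_⟩
    rw [← mul_sub, abs_mul]
    exact mul_le_mul_of_nonneg_right (hK t (abs_le.1 ht)) (abs_nonneg _))
    (by simp [hψ.position₁]) (by
      rw [hlin', (hd 0).deriv, h0, hF.force_zero, hψ.velocity₁]; simp) ht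
  rw [hlin', (hd t).deriv] at h2
  simpa using And.intro h1 h2

/-- The first column comes from ẋ₀ = ẋ₀(0)ψ₁ and the return of x₀ to its initial data at S; the
Wronskian then forces the other diagonal entry. Only ψ₂(S) is left to determine. -/
theorem fundamental_endpoint (hF : IsSymmetricForce F f) {x₀ ψ₁ ψ₂ : ℝ → ℝ}
    (hx₀ : SolvesNewton (fun x t => F x t 0) x₀) (h0 : x₀ 0 = 0) {S : ℝ} (hS : 0 ≤ S)
    (hS0 : x₀ S = 0) (hS1 : deriv x₀ S = deriv x₀ 0) (hη : deriv x₀ 0 ≠ 0)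
    (hψ : IsFundamentalPair (linearization F 0 x₀) ψ₁ ψ₂) :
    ψ₁ S = 1 ∧ deriv ψ₁ S = 0 ∧ deriv ψ₂ S = 1 := by
  obtain ⟨h1, h2⟩ := hF.deriv_eq_mul_fundamental hx₀ h0 hψ hS
  have h3 : ψ₁ S = 1 := by
    rw [hS1] at h1
    exact mul_left_cancel₀ hη (by rw [← h1, mul_one])
  have h4 : deriv ψ₁ S = 0 := by
    rw [hS0, hF.force_zero, neg_zero] at h2
    exact (mul_eq_zero.1 h2.symm).resolve_left hη
  refine ⟨h3, h4, ?_⟩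
  have := hψ.wronskian_eq_one S
  rw [h3, h4] at this
  linarith

/-- The endpoint of a perturbed solution, to first order in the change of initial velocity. -/
theorem exists_endpoint_estimate (hF : IsSymmetricForce F f) {x₀ ψ₁ ψ₂ : ℝ → ℝ}
    (hx₀ : SolvesNewton (fun x t => F x t 0) x₀) (h0 : x₀ 0 = 0) {S : ℝ} (hS : 0 ≤ S)
    (hS0 : x₀ S = 0) (hS1 : deriv x₀ S = deriv x₀ 0) (hη : deriv x₀ 0 ≠ 0)
    (hψ : IsFundamentalPair (linearization F 0 x₀) ψ₁ ψ₂) :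
    ∃ C r, 0 ≤ C ∧ 0 < r ∧ ∀ (e : ℝ) (x : ℝ → ℝ), |e| ≤ r →
      |deriv x 0 - deriv x₀ 0| ≤ r → SolvesNewton (fun x t => F x t e) x → x 0 = 0 →
      |x S - (deriv x 0 - deriv x₀ 0) * ψ₂ S| ≤ C * (|e| + |deriv x 0 - deriv x₀ 0| ^ 2) := by
  have hG := hF.contDiff_uncurry
  obtain ⟨h1, h2, h3⟩ := hF.fundamental_endpoint hx₀ h0 hS hS0 hS1 hη hψ
  obtain ⟨C₁, r, hC₁, hr, hr1, hstab⟩ := exists_newton_stability hG hx₀ hS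
  obtain ⟨R, hR0, hR⟩ := exists_abs_le_on_Icc hx₀.continuous S
  obtain ⟨C₂, hC₂, htay⟩ := exists_abs_taylor_le hG (R + S + 1)
  obtain ⟨C₃, hC₃, hE⟩ := exists_abs_le_on_Icc
    (g := fun t => partialE (uncurryForce F) (x₀ t, t, 0))
    ((contDiff_partialE hG).continuous.comp
      (hx₀.continuous.prodMk (continuous_id.prodMk continuous_const))) S
  -- χ = ψ₂(S)ψ₁ - ψ₂ satisfies χ(S) = 0, χ'(S) = -1 and χ(0) = ψ₂(S). Its Wronskian with u = x - x₀
  -- is therefore x(S) at time S and ψ₂(S) times the velocity change at time 0.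
  obtain ⟨hχ, hχ'⟩ := hψ.solves₁.linear_combination hψ.solves₂ (ψ₂ S) (-1)
  obtain ⟨M, hM0, hM⟩ := exists_abs_le_on_Icc hχ.continuous S
  refine ⟨(2 * C₂ * (C₁ + 1) ^ 2 + C₃) * M * S, r, by positivity, hr, ?_⟩
  intro e x he hv hx hx0
  set v := deriv x 0 - deriv x₀ 0 with hvdef
  have hst := hstab e x he hv hx (by rw [hx0, h0])
  have he1 : |e| ≤ 1 := he.trans hr1
  have hw := abs_wronskian_sub_le (u := fun t => x t - x₀ t)
    (u' := fun t => deriv x t - deriv x₀ t)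
    (u'' := fun t => -F (x t) t e - -F (x₀ t) t 0) (S := S)
    (ρ := (2 * C₂ * (C₁ + 1) ^ 2 + C₃) * (|e| + |v| ^ 2)) hS hχ
    (fun t => (hx.hasDerivAt t).sub (hx₀.hasDerivAt t)) (fun t => (hx.2 t).sub (hx₀.2 t))
    (by
      intro t ht
      obtain ⟨ha, -, hc⟩ := hst t ht
      have hRt := hR t ht
      have hxt : |x t| ≤ R + 1 := by
        calc |x t| = |(x t - x₀ t) + x₀ t| := by ring_nf
          _ ≤ |x t - x₀ t| + |x₀ t| := abs_add_le _ _
          _ ≤ _ := by linarith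
      have hT := htay (x₀ t) (x t) t e (by linarith) (by linarith)
        (by rw [abs_of_nonneg ht.1]; linarith [ht.2]) (by linarith)
      have hEt := hE t ht
      have hsum : |x t - x₀ t| + |e| ≤ (C₁ + 1) * (|e| + |v|) := by
        nlinarith [abs_nonneg e, abs_nonneg v]
      have hsq : (|x t - x₀ t| + |e|) ^ 2 ≤ (C₁ + 1) ^ 2 * (2 * (|e| + |v| ^ 2)) := by
        calc (|x t - x₀ t| + |e|) ^ 2 ≤ ((C₁ + 1) * (|e| + |v|)) ^ 2 :=
              pow_le_pow_left₀ (by positivity) hsum 2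
          _ = (C₁ + 1) ^ 2 * (|e| + |v|) ^ 2 := by ring
          _ ≤ _ := by
            refine mul_le_mul_of_nonneg_left ?_ (by positivity)
            nlinarith [sq_nonneg (|e| - |v|), abs_nonneg e]
      have hEe : |partialE (uncurryForce F) (x₀ t, t, 0) * e| ≤ C₃ * (|e| + |v| ^ 2) := by
        rw [abs_mul]
        refine mul_le_mul hEt ?_ (abs_nonneg e) hC₃
        nlinarith [sq_nonneg |v|]
      rw [hF.linearization_eq]
      have hid : -F (x t) t e - -F (x₀ t) t 0 +
          partialX (uncurryForce F) (x₀ t, t, 0) * (x t - x₀ t) =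
          -(uncurryForce F (x t, t, e) - uncurryForce F (x₀ t, t, 0) -
            (partialX (uncurryForce F) (x₀ t, t, 0) * (x t - x₀ t) +
              partialE (uncurryForce F) (x₀ t, t, 0) * e)) -
            partialE (uncurryForce F) (x₀ t, t, 0) * e := by
        simp only [uncurryForce]; ring
      rw [hid]
      refine (abs_sub _ _).trans ?_
      rw [abs_neg]
      have := mul_le_mul_of_nonneg_left hsq hC₂
      linarith) hM
  rw [hχ' S, hχ' 0, h1, h2, h3, hψ.position₁, hψ.velocity₁, hψ.position₂, hψ.velocity₂, hS0, h0,
    hx0, ← hvdef] at hw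
  calc |x S - v * ψ₂ S| = _ := by congr 1; ring
    _ ≤ _ := hw
    _ = _ := by ring

/-- The derivative of the endpoint with respect to the initial velocity, in terms of the
derivative of the period function. -/
theorem fundamental_endpoint_eq (hF : IsSymmetricForce F f) {x₀ ψ₁ ψ₂ : ℝ → ℝ} {h : ℝ}
    (hh : 0 < h) {p : ℕ} (hp : 0 < p)
    (hx₀ : SolvesNewton (fun x t => F x t 0) x₀) (h0 : x₀ 0 = 0)
    (hη : deriv x₀ 0 = Real.sqrt (2 * h)) {S : ℝ} (hS : 0 < S)
    (hS0 : x₀ S = 0) (hS1 : deriv x₀ S = deriv x₀ 0) (hT : p * periodFunction f h = S)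
    (hd : DifferentiableAt ℝ (periodFunction f) h)
    (hψ : IsFundamentalPair (linearization F 0 x₀) ψ₁ ψ₂) :
    ψ₂ S = -p * (2 * h) * deriv (periodFunction f) h := by
  have hG := hF.contDiff_uncurry
  have hηpos : 0 < Real.sqrt (2 * h) := Real.sqrt_pos.2 (by linarith)
  have hp' : (0 : ℝ) < p := Nat.cast_pos.2 hp
  obtain ⟨C₁, r₁, hC₁, hr₁, hend⟩ := hF.exists_endpoint_estimate hx₀ h0 hS.le hS0 hS1
    (by rw [hη]; exact hηpos.ne') hψ
  obtain ⟨C₂, r₂, hC₂, hr₂, -, hstab⟩ := exists_newton_stability hG hx₀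
    (S := S + 1) (by linarith)
  obtain ⟨C₃, hC₃, hf⟩ := exists_abs_le_on_Icc (g := fun t => -F (x₀ t) t 0)
    (hG.continuous.comp (hx₀.continuous.prodMk (continuous_id.prodMk continuous_const))).neg
    (S + 1)
  set η := Real.sqrt (2 * h) with hηdef
  set v : ℝ → ℝ := fun k => Real.sqrt (2 * k) - η with hvdef
  set σ : ℝ → ℝ := fun k => S - p * periodFunction f k with hσdef
  have hv : HasDerivAt v (1 / η) h := by
    have := (((hasDerivAt_id h).const_mul 2).sqrt (by simp only [id]; linarith)).sub_const η
    refine this.congr_deriv ?_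
    simp only [id, ← hηdef]
    field_simp
  have hσ : HasDerivAt σ (-(p * deriv (periodFunction f) h)) h :=
    (hd.hasDerivAt.const_mul (p : ℝ)).const_sub S
  have hv0 : v h = 0 := sub_self _
  have hσ0 : σ h = 0 := by simp only [hσdef, hT, sub_self]
  have hTpos : 0 < periodFunction f h := by
    rw [← hT] at hS
    exact (mul_pos_iff_of_pos_left hp').1 hS
  set C := C₁ + C₂ + C₃
  -- Let y be the solution with velocity √(2k). Its value at S is v(k)ψ₂(S) up to O(v²). It is also
  -- ησ(k) up to second order, since y vanishes at S - σ(k) and its velocity in between is close to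
  -- η.
  have hest : ∀ᶠ k in 𝓝 h, |η * σ k - v k * ψ₂ S| ≤ C * (2 * (|v k| ^ 2 + |σ k| ^ 2)) := by
    have e1 : ∀ᶠ k in 𝓝 h, |v k| < r₁ ∧ |v k| < r₂ ∧ |σ k| < 1 := by
      have hvc : Tendsto (fun k => |v k|) (𝓝 h) (𝓝 0) := by
        simpa [hv0] using hv.continuousAt.abs.tendsto
      have hσc : Tendsto (fun k => |σ k|) (𝓝 h) (𝓝 0) := by
        simpa [hσ0] using hσ.continuousAt.abs.tendsto
      exact (hvc.eventually_lt_const hr₁).and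
        ((hvc.eventually_lt_const hr₂).and (hσc.eventually_lt_const one_pos))
    filter_upwards [e1, hd.continuousAt.eventually (eventually_gt_nhds hTpos)]
      with k ⟨hk1, hk2, hk3⟩ hkT
    obtain ⟨y, hy, hy0, hy1, hyp⟩ := hF.exists_solution_of_periodFunction_pos hkT
    have hvk : deriv y 0 - deriv x₀ 0 = v k := by rw [hy1, hη]
    have hE := hend 0 y (by simpa using hr₁.le) (by rw [hvk]; exact hk1.le) hy hy0
    rw [hvk, abs_zero, zero_add] at hE
    set s := p * periodFunction f k with hs
    have hs0 : 0 < s := mul_pos hp' hkT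
    have hσs : σ k = S - s := rfl
    have hys : y s = 0 := hyp p
    rw [hσs] at hk3 ⊢
    have hmem : uIcc s S ⊆ Icc 0 (S + 1) := by
      have := abs_lt.1 hk3
      exact uIcc_subset_Icc ⟨hs0.le, by linarith⟩ ⟨hS.le, by linarith⟩
    have hsp : ∀ t ∈ uIcc s S, |deriv y t - η| ≤ C₂ * |v k| + C₃ * |S - s| := by
      intro t ht
      have h1 := (hstab 0 y (by simpa using hr₂.le) (by rw [hvk]; exact hk2.le) hy
        (by rw [hy0, h0]) t (hmem ht)).2.1
      rw [hvk, abs_zero, zero_add] at h1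
      have h2 := (convex_uIcc s S).norm_image_sub_le_of_norm_hasDerivWithin_le
        (f := deriv x₀) (C := C₃) (fun t _ => (hx₀.2 t).hasDerivWithinAt)
        (fun t ht => hf t (hmem ht)) right_mem_uIcc ht
      rw [hS1, hη, Real.norm_eq_abs, Real.norm_eq_abs] at h2
      have h3 : |t - S| ≤ |S - s| := by
        rw [abs_sub_comm t S]
        exact abs_sub_right_of_mem_uIcc ht
      have h4 := mul_le_mul_of_nonneg_left h3 hC₃
      calc |deriv y t - η| = |(deriv y t - deriv x₀ t) + (deriv x₀ t - η)| := by ring_nf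
        _ ≤ |deriv y t - deriv x₀ t| + |deriv x₀ t - η| := abs_add_le _ _
        _ ≤ _ := by linarith
    have hmv := (convex_uIcc s S).norm_image_sub_le_of_norm_hasDerivWithin_le
      (f := fun t => y t - η * t) (C := C₂ * |v k| + C₃ * |S - s|)
      (fun t _ => ((hy.hasDerivAt t).sub ((hasDerivAt_id t).const_mul η)).hasDerivWithinAt)
      (fun t ht => by simpa using hsp t ht) left_mem_uIcc right_mem_uIcc
    simp only [hys, Real.norm_eq_abs] at hmv
    have hfin : |η * (S - s) - v k * ψ₂ S| ≤ C₁ * |v k| ^ 2 +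
        (C₂ * |v k| + C₃ * |S - s|) * |S - s| := by
      calc |η * (S - s) - v k * ψ₂ S|
          = |(y S - v k * ψ₂ S) - (y S - η * S - (0 - η * s))| := by ring_nf
        _ ≤ |y S - v k * ψ₂ S| + |y S - η * S - (0 - η * s)| := abs_sub _ _
        _ ≤ _ := by linarith
    refine hfin.trans ?_
    have := mul_nonneg hC₂ (sq_nonneg (|v k| - |S - s|))
    have := mul_nonneg hC₁ (sq_nonneg |v k|)
    have := mul_nonneg hC₁ (sq_nonneg |S - s|)
    have := mul_nonneg hC₂ (sq_nonneg |v k|)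
    have := mul_nonneg hC₂ (sq_nonneg |S - s|)
    have := mul_nonneg hC₃ (sq_nonneg |v k|)
    have := mul_nonneg hC₃ (sq_nonneg |S - s|)
    simp only [C]
    nlinarith
  have hO : (fun k => |v k| ^ 2 + |σ k| ^ 2) =O[𝓝 h] fun k => ‖k - h‖ ^ 2 := by
    have h1 : v =O[𝓝 h] fun k => k - h := by simpa [hv0] using hv.isBigO_sub
    have h2 : σ =O[𝓝 h] fun k => k - h := by simpa [hσ0] using hσ.isBigO_sub
    exact (h1.abs_left.norm_right.pow 2).add (h2.abs_left.norm_right.pow 2)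
  -- The quadratic bound makes this derivative 0; computing it from σ' and v' as well gives the
  -- equation for ψ₂(S).
  have hg0 : HasDerivAt (fun k => η * σ k - v k * ψ₂ S) 0 h := by
    have hO' : (fun k => η * σ k - v k * ψ₂ S) =O[𝓝 h] fun k => ‖k - h‖ ^ 2 := by
      refine (Asymptotics.IsBigO.of_bound (2 * C) ?_).trans hO
      filter_upwards [hest] with k hk
      rw [Real.norm_eq_abs, Real.norm_of_nonneg (by positivity)]
      linarith
    rw [hasDerivAt_iff_isLittleO]
    simp only [hv0, hσ0, mul_zero, zero_mul, sub_zero, smul_zero]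
    exact hO'.trans_isLittleO (Asymptotics.isLittleO_pow_sub_sub h one_lt_two)
  have hg1 : HasDerivAt (fun k => η * σ k - v k * ψ₂ S)
      (η * -(p * deriv (periodFunction f) h) - 1 / η * ψ₂ S) h :=
    (hσ.const_mul η).sub (hv.mul_const _)
  have heq := hg1.unique hg0
  have hη2 : η * η = 2 * h := Real.mul_self_sqrt (by linarith)
  field_simp at heq
  rw [← hη2]
  linarith

end IsSymmetricForce

/-! ### Variation of the trace with the Hill potential. -/

/-- The mean value inequality is applied to W minus the primitive of g, so W' itself need not be
integrable. -/
theorem abs_sub_sub_integral_le {W W' g : ℝ → ℝ} {S ρ : ℝ} (hS : 0 ≤ S)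
    (hW : ∀ t, HasDerivAt W (W' t) t) (hg : Continuous g)
    (hρ : ∀ t ∈ Icc 0 S, |W' t - g t| ≤ ρ) :
    |W S - W 0 - ∫ t in (0 : ℝ)..S, g t| ≤ ρ * S := by
  have hd : ∀ t, HasDerivAt (fun t => W t - ∫ s in (0 : ℝ)..t, g s) (W' t - g t) t := fun t =>
    (hW t).sub (hg.integral_hasStrictDerivAt 0 t).hasDerivAt
  have := (convex_Icc 0 S).norm_image_sub_le_of_norm_hasDerivWithin_le
    (fun t _ => (hd t).hasDerivWithinAt) hρ (left_mem_Icc.2 hS) (right_mem_Icc.2 hS)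
  simp only [intervalIntegral.integral_same, sub_zero, Real.norm_eq_abs, abs_of_nonneg hS] at this
  rwa [sub_right_comm] at this

/-- Lipschitz dependence of the solutions of Hill's equation on the potential. -/
theorem exists_hill_stability {q₀ ψ : ℝ → ℝ} (hq₀ : Continuous q₀)
    (hψ : SolvesNewton (fun y t => q₀ t * y) ψ) (S : ℝ) :
    ∃ C r, 0 ≤ C ∧ 0 < r ∧ ∀ (q y : ℝ → ℝ) (κ : ℝ), SolvesNewton (fun y t => q t * y) y →
      y 0 = ψ 0 → deriv y 0 = deriv ψ 0 → 0 ≤ κ → κ ≤ r →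
      (∀ t ∈ Icc 0 S, |q t - q₀ t| ≤ κ) → ∀ t ∈ Icc 0 S, |y t - ψ t| ≤ C * κ := by
  obtain ⟨K, hK0, hK⟩ := exists_abs_le_on_Icc hq₀ S
  obtain ⟨M, hM0, hM⟩ := exists_abs_le_on_Icc hψ.continuous S
  set E := Real.exp ((K + 1 + 2) * S)
  have hE : 0 < E := Real.exp_pos _
  -- This radius gives both κME < 1 for Gronwall and κ ≤ 1, so that |q| ≤ K + 1.
  refine ⟨M * E, 1 / (M * E + 1), by positivity, by positivity, ?_⟩
  intro q y κ hy h0 h0' hκ hκr hq t ht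
  have hκ1 : κ ≤ 1 := hκr.trans (by
    rw [div_le_one (by positivity)]; nlinarith [mul_nonneg hM0 hE.le])
  have hlt : (0 + κ * M) * E < 1 := by
    rw [le_div_iff₀ (by positivity)] at hκr
    rcases hκ.eq_or_lt with h | h
    · simp [← h]
    · nlinarith
  have := (gronwall_second_order (u := fun s => y s - ψ s)
    (u' := fun s => deriv y s - deriv ψ s) (u'' := fun s => -(q s * y s) - -(q₀ s * ψ s))
    (K := K + 1) (ε := κ * M) (δ := 0) (S := S) (by positivity) (by positivity) le_rfl
    (fun s => (hy.hasDerivAt s).sub (hψ.hasDerivAt s)) (fun s => (hy.2 s).sub (hψ.2 s))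
    (by simp [h0]) (by simp [h0']) hlt (fun s hs _ => by
      rw [show -(q s * y s) - -(q₀ s * ψ s) =
        -((q₀ s + (q s - q₀ s)) * (y s - ψ s) + (q s - q₀ s) * ψ s) by ring, abs_neg]
      refine (abs_add_le _ _).trans ?_
      rw [abs_mul, abs_mul]
      refine add_le_add (mul_le_mul_of_nonneg_right ?_ (abs_nonneg _))
        (mul_le_mul (hq s hs) (hM s hs) (abs_nonneg _) hκ)
      exact (abs_add_le _ _).trans (add_le_add (hK s hs) ((hq s hs).trans hκ1))) t ht).1
  exact this.trans_eq (by rw [zero_add]; ring)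

/-- First variation of the trace of a parabolic Poincaré matrix. -/
theorem exists_trace_variation {q₀ ψ₁ ψ₂ : ℝ → ℝ} (hq₀ : Continuous q₀)
    (hψ : IsFundamentalPair q₀ ψ₁ ψ₂) {S : ℝ} (hS : 0 ≤ S) (h₁ : ψ₁ S = 1)
    (h₁' : deriv ψ₁ S = 0) (h₂' : deriv ψ₂ S = 1) :
    ∃ C r, 0 ≤ C ∧ 0 < r ∧ ∀ (q y₁ y₂ : ℝ → ℝ) (κ : ℝ), Continuous q →
      IsFundamentalPair q y₁ y₂ → 0 ≤ κ → κ ≤ r → (∀ t ∈ Icc 0 S, |q t - q₀ t| ≤ κ) →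
      |(y₁ S + deriv y₂ S) - (ψ₁ S + deriv ψ₂ S) +
        ψ₂ S * ∫ t in (0 : ℝ)..S, (q t - q₀ t) * ψ₁ t ^ 2| ≤ C * κ ^ 2 := by
  obtain ⟨C₁, r₁, hC₁, hr₁, hs₁⟩ := exists_hill_stability hq₀ hψ.solves₁ S
  obtain ⟨C₂, r₂, hC₂, hr₂, hs₂⟩ := exists_hill_stability hq₀ hψ.solves₂ S
  obtain ⟨M₁, hM₁0, hM₁⟩ := exists_abs_le_on_Icc hψ.solves₁.continuous S
  obtain ⟨M₂, hM₂0, hM₂⟩ := exists_abs_le_on_Icc hψ.solves₂.continuous S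
  set b := ψ₂ S with hb
  refine ⟨(|b| * (C₁ * M₁) + C₁ * M₂ + C₂ * M₁) * S, min r₁ r₂, by positivity, lt_min hr₁ hr₂, ?_⟩
  intro q y₁ y₂ κ hq hy hκ hκr hqκ
  have hD₁ := hs₁ q y₁ κ hy.solves₁ (by rw [hy.position₁, hψ.position₁])
    (by rw [hy.velocity₁, hψ.velocity₁]) hκ (hκr.trans (min_le_left _ _)) hqκ
  have hD₂ := hs₂ q y₂ κ hy.solves₂ (by rw [hy.position₂, hψ.position₂])
    (by rw [hy.velocity₂, hψ.velocity₂]) hκ (hκr.trans (min_le_right _ _)) hqκ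
  have dW : ∀ {y z : ℝ → ℝ}, SolvesNewton (fun y t => q t * y) y →
      SolvesNewton (fun y t => q₀ t * y) z → ∀ t,
      HasDerivAt (fun t => deriv y t * z t - y t * deriv z t) (-((q t - q₀ t) * y t * z t)) t :=
    fun hy hz t => (((hy.2 t).mul (hz.hasDerivAt t)).sub
      ((hy.hasDerivAt t).mul (hz.2 t))).congr_deriv (by ring)
  -- This combination of Wronskians equals y₁(S) + y₂'(S) at S and 2 at 0. When y₁, y₂ are replaced
  -- by ψ₁, ψ₂ in its derivative, the two ψ₁ψ₂ terms cancel and -b(q - q₀)ψ₁² remains; the error is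
  -- quadratic in κ.
  have hW : ∀ t, HasDerivAt (fun t => b * (deriv y₁ t * ψ₁ t - y₁ t * deriv ψ₁ t) -
      (deriv y₁ t * ψ₂ t - y₁ t * deriv ψ₂ t) + (deriv y₂ t * ψ₁ t - y₂ t * deriv ψ₁ t))
      (b * -((q t - q₀ t) * y₁ t * ψ₁ t) - -((q t - q₀ t) * y₁ t * ψ₂ t) +
        -((q t - q₀ t) * y₂ t * ψ₁ t)) t := fun t =>
    (((dW hy.solves₁ hψ.solves₁ t).const_mul b).sub (dW hy.solves₁ hψ.solves₂ t)).add
      (dW hy.solves₂ hψ.solves₁ t)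
  have := abs_sub_sub_integral_le (g := fun t => -b * ((q t - q₀ t) * ψ₁ t ^ 2))
    (ρ := (|b| * (C₁ * M₁) + C₁ * M₂ + C₂ * M₁) * κ ^ 2) hS hW
    (continuous_const.mul ((hq.sub hq₀).mul (hψ.solves₁.continuous.pow 2))) (fun t ht => by
      have e₁ := hD₁ t ht
      have e₂ := hD₂ t ht
      have m₁ := hM₁ t ht
      have m₂ := hM₂ t ht
      have eq := hqκ t ht
      have a₁ : |(y₁ t - ψ₁ t) * ψ₁ t| ≤ C₁ * κ * M₁ := by
        rw [abs_mul]; exact mul_le_mul e₁ m₁ (abs_nonneg _) (by positivity)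
      have a₂ : |(y₁ t - ψ₁ t) * ψ₂ t| ≤ C₁ * κ * M₂ := by
        rw [abs_mul]; exact mul_le_mul e₁ m₂ (abs_nonneg _) (by positivity)
      have a₃ : |(y₂ t - ψ₂ t) * ψ₁ t| ≤ C₂ * κ * M₁ := by
        rw [abs_mul]; exact mul_le_mul e₂ m₁ (abs_nonneg _) (by positivity)
      have hid : b * -((q t - q₀ t) * y₁ t * ψ₁ t) - -((q t - q₀ t) * y₁ t * ψ₂ t) +
          -((q t - q₀ t) * y₂ t * ψ₁ t) - -b * ((q t - q₀ t) * ψ₁ t ^ 2) =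
          (q t - q₀ t) * (-b * ((y₁ t - ψ₁ t) * ψ₁ t) + (y₁ t - ψ₁ t) * ψ₂ t -
            (y₂ t - ψ₂ t) * ψ₁ t) := by ring
      rw [hid, abs_mul]
      have hsum : |-b * ((y₁ t - ψ₁ t) * ψ₁ t) + (y₁ t - ψ₁ t) * ψ₂ t -
          (y₂ t - ψ₂ t) * ψ₁ t| ≤ |b| * (C₁ * κ * M₁) + C₁ * κ * M₂ + C₂ * κ * M₁ := by
        refine (abs_sub _ _).trans (add_le_add ((abs_add_le _ _).trans (add_le_add ?_ a₂)) a₃)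
        rw [abs_mul, abs_neg]
        exact mul_le_mul_of_nonneg_left a₁ (abs_nonneg _)
      calc _ ≤ κ * (|b| * (C₁ * κ * M₁) + C₁ * κ * M₂ + C₂ * κ * M₁) :=
            mul_le_mul eq hsum (abs_nonneg _) hκ
        _ = _ := by ring)
  simp only [h₁, h₁', h₂', ← hb, hy.position₁, hy.position₂, hy.velocity₁, hy.velocity₂,
    hψ.position₁, hψ.position₂, hψ.velocity₁, hψ.velocity₂,
    intervalIntegral.integral_const_mul] at this
  rw [h₁, h₂']
  calc _ = _ := by congr 1; ring
    _ ≤ _ := this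
    _ = _ := by ring

/-! ### The perturbed branch and its linearized potential. -/

namespace IsSymmetricForce

variable {F : ℝ → ℝ → ℝ → ℝ} {f : ℝ → ℝ}

/-- The branch is Lipschitz at `e = 0`. -/
theorem exists_branch_bound (hF : IsSymmetricForce F f) {m : ℕ} {η e₀ : ℝ} {V : ℝ → ℝ}
    {φ : ℝ → ℝ → ℝ} (hφ : IsOddBranch F m η e₀ V φ) (hη : 0 < η) {ψ₁ ψ₂ : ℝ → ℝ}
    (hψ : IsFundamentalPair (linearization F 0 (φ 0)) ψ₁ ψ₂) (hb : ψ₂ (2 * m * Real.pi) ≠ 0) :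
    ∃ C, 0 ≤ C ∧ ∀ᶠ e in 𝓝[≥] (0 : ℝ), ∀ t ∈ Icc 0 (2 * m * Real.pi),
      |φ e t - φ 0 t| ≤ C * e ∧ |φ e t - φ 0 t| ≤ 1 := by
  set S := 2 * m * Real.pi
  have hS : 0 ≤ S := by positivity
  have h00 : (0 : ℝ) ∈ Ico 0 e₀ := ⟨le_rfl, hφ.pos⟩
  obtain ⟨hS0, hS1⟩ := hF.reflect_solution (hφ.solves 0 h00) (hφ.initial_position 0 h00)
    (hφ.endpoint 0 h00)
  have hV0 : deriv (φ 0) 0 = η := by rw [hφ.initial_velocity 0 h00, hφ.start]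
  obtain ⟨C₁, r₁, hC₁, hr₁, hend⟩ := hF.exists_endpoint_estimate (hφ.solves 0 h00)
    (hφ.initial_position 0 h00) hS hS0 hS1 (by rw [hV0]; exact hη.ne') hψ
  obtain ⟨C₂, r₂, hC₂, hr₂, -, hstab⟩ := exists_newton_stability hF.contDiff_uncurry
    (hφ.solves 0 h00) hS
  set b := ψ₂ S
  have hb' : 0 < |b| := abs_pos.2 hb
  refine ⟨C₂ * (1 + 2 * C₁ / |b|), by positivity, ?_⟩
  have hIco : ∀ᶠ e in 𝓝[≥] (0 : ℝ), e ∈ Ico 0 e₀ := Ico_mem_nhdsGE hφ.pos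
  have hVlim : Tendsto (fun e => |V e - η|) (𝓝[≥] 0) (𝓝 0) := by
    have h1 : Tendsto V (𝓝[≥] 0) (𝓝 (V 0)) := by
      have := hφ.continuousOn 0 h00
      rwa [ContinuousWithinAt, nhdsWithin_Ico_eq_nhdsGE hφ.pos] at this
    have h2 := (h1.sub_const η).abs
    rwa [hφ.start, sub_self, abs_zero] at h2
  have helim : Tendsto (fun e : ℝ => |e|) (𝓝[≥] 0) (𝓝 0) := by
    have := (continuous_abs : Continuous fun e : ℝ => |e|).tendsto 0
    rw [abs_zero] at this
    exact this.mono_left nhdsWithin_le_nhds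
  filter_upwards [hIco, hVlim.eventually_lt_const hr₁, hVlim.eventually_lt_const hr₂,
    (hVlim.const_mul (2 * C₁)).eventually_lt_const (u := |b|) (by rwa [mul_zero]),
    helim.eventually_lt_const hr₁, helim.eventually_lt_const hr₂] with e he v1 v2 v3 e1 e2
  have hVe : deriv (φ e) 0 - deriv (φ 0) 0 = V e - η := by
    rw [hφ.initial_velocity e he, hV0]
  obtain ⟨hSe, -⟩ := hF.reflect_solution (hφ.solves e he) (hφ.initial_position e he)
    (hφ.endpoint e he)
  have hE := hend e (φ e) e1.le (by rw [hVe]; exact v1.le) (hφ.solves e he)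
    (hφ.initial_position e he)
  have hst := hstab e (φ e) e2.le (by rw [hVe]; exact v2.le) (hφ.solves e he)
    (by rw [hφ.initial_position e he, hφ.initial_position 0 h00])
  rw [hVe, abs_of_nonneg he.1] at hst
  rw [hVe, hSe, zero_sub, abs_neg, abs_mul, abs_of_nonneg he.1] at hE
  -- The endpoint estimate reads |V - η||b| ≤ C₁(e + |V - η|²). Continuity of V gives 2C₁|V - η| <
  -- |b|, so the quadratic term is absorbed into half of the left side.
  have hVb : |V e - η| ≤ 2 * C₁ / |b| * e := by
    rw [div_mul_eq_mul_div, le_div_iff₀ hb']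
    nlinarith [abs_nonneg (V e - η)]
  intro t ht
  obtain ⟨h1, -, h3⟩ := hst t ht
  refine ⟨h1.trans ?_, h3⟩
  rw [mul_assoc]
  exact mul_le_mul_of_nonneg_left (by linarith) hC₂

/-- The first variation of the linearized potential, tested against the squared velocity of the
unperturbed solution. -/
theorem exists_integral_potential_variation (hF : IsSymmetricForce F f) {x₀ : ℝ → ℝ}
    (hx₀ : SolvesNewton (fun x t => F x t 0) x₀) (h0 : x₀ 0 = 0) {S : ℝ} (hS : 0 ≤ S)
    (hS0 : x₀ S = 0) (C : ℝ) :
    ∃ C', 0 ≤ C' ∧ ∀ (e : ℝ) (x : ℝ → ℝ), 0 ≤ e → e ≤ 1 →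
      SolvesNewton (fun x t => F x t e) x → x 0 = 0 → x S = 0 →
      (∀ t ∈ Icc 0 S, |x t - x₀ t| ≤ C * e ∧ |x t - x₀ t| ≤ 1) →
      (∀ t ∈ Icc 0 S, |linearization F e x t - linearization F 0 x₀ t| ≤ C' * e) ∧
      |∫ t in (0 : ℝ)..S, ((linearization F e x t - linearization F 0 x₀ t) * deriv x₀ t ^ 2 +
        e * (mixedPartial F (x₀ t) t 0 * deriv x₀ t))| ≤ C' * e ^ 2 := by
  have hG := hF.contDiff_uncurry
  have hGx := contDiff_partialX hG
  have hGe := contDiff_partialE hG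
  set G := uncurryForce F with hGdef
  obtain ⟨R, hR0, hR⟩ := exists_abs_le_on_Icc hx₀.continuous S
  obtain ⟨C₁, hC₁, hlip⟩ := exists_abs_sub_le hGx (R + S + 1)
  obtain ⟨C₂, hC₂, htay⟩ := exists_abs_taylor_le hG (R + S + 1)
  obtain ⟨C₃, hC₃, htayx⟩ := exists_abs_taylor_le hGx (R + S + 1)
  obtain ⟨M₁, hM₁0, hM₁⟩ := exists_abs_le_on_Icc (hx₀.continuous_deriv.pow 2) S
  have hfc : Continuous fun t => f (x₀ t) :=
    continuous_iff_continuousAt.2 fun t => (hF.hasDerivAt_force hx₀ t).continuousAt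
  obtain ⟨M₂, hM₂0, hM₂⟩ := exists_abs_le_on_Icc hfc S
  set D := (C + 1) ^ 2
  refine ⟨C₁ * (|C| + 1) + (C₃ * D * M₁ + C₂ * D * M₂) * S, by positivity, ?_⟩
  intro e x he he1 hx hx0 hxS hδ
  have hin : ∀ t ∈ Icc 0 S, |x₀ t| ≤ R + S + 1 ∧ |x t| ≤ R + S + 1 ∧ |t| ≤ R + S + 1 ∧
      |e| ≤ R + S + 1 := by
    intro t ht
    have h1 := hR t ht
    have h2 := (hδ t ht).2
    refine ⟨by linarith, ?_, ?_, ?_⟩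
    · calc |x t| = |(x t - x₀ t) + x₀ t| := by ring_nf
        _ ≤ |x t - x₀ t| + |x₀ t| := abs_add_le _ _
        _ ≤ _ := by linarith
    · rw [abs_of_nonneg ht.1]; linarith [ht.2]
    · rw [abs_of_nonneg he]; linarith
  have hsq : ∀ t ∈ Icc 0 S, (|x t - x₀ t| + |e|) ^ 2 ≤ D * e ^ 2 := by
    intro t ht
    have h1 := (hδ t ht).1
    calc (|x t - x₀ t| + |e|) ^ 2 ≤ ((C + 1) * e) ^ 2 := by
          refine pow_le_pow_left₀ (by positivity) ?_ 2
          rw [abs_of_nonneg he]; linarith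
      _ = _ := by ring
  have hd : ∀ t, HasDerivAt (linearization F 0 x₀)
      (partialX (partialX G) (x₀ t, t, 0) * deriv x₀ t) t := by
    intro t
    rw [funext (hF.linearization_eq 0 x₀)]
    refine (hasDerivAt_comp_curve hGx (hx₀.hasDerivAt t) (hasDerivAt_id t)
      (hasDerivAt_const t 0)).congr_deriv ?_
    simp only [id, hGdef, hF.partialT_partialX_zero]
    ring
  have hdE : ∀ t, HasDerivAt (fun t => partialE G (x₀ t, t, 0))
      (partialE (partialX G) (x₀ t, t, 0) * deriv x₀ t + mixedPartial F (x₀ t) t 0) t := by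
    intro t
    refine (hasDerivAt_comp_curve hGe (hx₀.hasDerivAt t) (hasDerivAt_id t)
      (hasDerivAt_const t 0)).congr_deriv ?_
    rw [← partialX_partialE_comm hG, hF.mixedPartial_eq, ← hGdef]
    simp only [id]
    ring
  have hxd : ∀ t, HasDerivAt (deriv x₀) (-f (x₀ t)) t := fun t =>
    (hx₀.2 t).congr_deriv (congrArg Neg.neg (hF.autonomous _ t))
  -- With δ = x - x₀, the primitive is q₀ẋ₀δ + eF_e ẋ₀ - f(x₀)δ'. Using ẍ₀ = -f(x₀), its derivative
  -- is the linearization of the integrand plus f(x₀) times the Taylor remainder of F.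
  have hA : ∀ t, HasDerivAt (fun t => linearization F 0 x₀ t * deriv x₀ t * (x t - x₀ t) +
      e * (partialE G (x₀ t, t, 0) * deriv x₀ t) - f (x₀ t) * (deriv x t - deriv x₀ t))
      ((partialX (partialX G) (x₀ t, t, 0) * (x t - x₀ t) +
        partialE (partialX G) (x₀ t, t, 0) * e) * deriv x₀ t ^ 2 +
        e * (mixedPartial F (x₀ t) t 0 * deriv x₀ t) +
        f (x₀ t) * (G (x t, t, e) - G (x₀ t, t, 0) -
          (partialX G (x₀ t, t, 0) * (x t - x₀ t) + partialE G (x₀ t, t, 0) * e))) t := by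
    intro t
    refine (((((hd t).mul (hxd t)).mul ((hx.hasDerivAt t).sub (hx₀.hasDerivAt t))).add
      (((hdE t).mul (hxd t)).const_mul e)).sub ((hF.hasDerivAt_force hx₀ t).mul
        ((hx.2 t).sub (hx₀.2 t)))).congr_deriv ?_
    simp only [Pi.mul_apply, Pi.sub_apply, hF.linearization_eq, hGdef, uncurryForce]
    ring
  refine ⟨fun t ht => ?_, ?_⟩
  · obtain ⟨i1, i2, i3, i4⟩ := hin t ht
    rw [hF.linearization_eq, hF.linearization_eq]
    refine (hlip _ _ t e i1 i2 i3 i4).trans ?_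
    have h1 : |x t - x₀ t| + |e| ≤ (|C| + 1) * e := by
      have := mul_le_mul_of_nonneg_right (le_abs_self C) he
      rw [abs_of_nonneg he]
      linarith [(hδ t ht).1]
    have h2 := mul_le_mul_of_nonneg_left h1 hC₁
    have h3 : 0 ≤ (C₃ * D * M₁ + C₂ * D * M₂) * S * e := by positivity
    linarith
  · have hmix : Continuous fun t => mixedPartial F (x₀ t) t 0 := by
      simp only [hF.mixedPartial_eq]
      exact (contDiff_partialT hGe).continuous.comp
        (hx₀.continuous.prodMk (continuous_id.prodMk continuous_const))
    have key := abs_sub_sub_integral_le (g := fun t =>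
        (linearization F e x t - linearization F 0 x₀ t) * deriv x₀ t ^ 2 +
        e * (mixedPartial F (x₀ t) t 0 * deriv x₀ t))
      (ρ := (C₃ * D * M₁ + C₂ * D * M₂) * e ^ 2) hS hA
      ((((hF.continuous_linearization e hx.continuous).sub
        (hF.continuous_linearization 0 hx₀.continuous)).mul (hx₀.continuous_deriv.pow 2)).add
        (continuous_const.mul (hmix.mul hx₀.continuous_deriv))) (fun t ht => by
        obtain ⟨i1, i2, i3, i4⟩ := hin t ht
        have t1 := (htay _ _ t e i1 i2 i3 i4).trans (mul_le_mul_of_nonneg_left (hsq t ht) hC₂)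
        have t2 := (htayx _ _ t e i1 i2 i3 i4).trans (mul_le_mul_of_nonneg_left (hsq t ht) hC₃)
        rw [hF.linearization_eq, hF.linearization_eq]
        set r₁ := G (x t, t, e) - G (x₀ t, t, 0) -
          (partialX G (x₀ t, t, 0) * (x t - x₀ t) + partialE G (x₀ t, t, 0) * e)
        set r₂ := partialX G (x t, t, e) - partialX G (x₀ t, t, 0) -
          (partialX (partialX G) (x₀ t, t, 0) * (x t - x₀ t) +
            partialE (partialX G) (x₀ t, t, 0) * e) with hr₂
        calc _ = |f (x₀ t) * r₁ - r₂ * deriv x₀ t ^ 2| := by congr 1; rw [hr₂]; ring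
          _ ≤ |f (x₀ t) * r₁| + |r₂ * deriv x₀ t ^ 2| := abs_sub _ _
          _ ≤ M₂ * (C₂ * (D * e ^ 2)) + C₃ * (D * e ^ 2) * M₁ := by
            rw [abs_mul, abs_mul]
            exact add_le_add (mul_le_mul (hM₂ t ht) t1 (abs_nonneg _) hM₂0)
              (mul_le_mul t2 (hM₁ t ht) (abs_nonneg _) (by positivity))
          _ = _ := by ring)
    -- Every boundary term vanishes: x = x₀ = 0 at both ends, and f and F_e vanish at the origin.
    simp only [h0, hS0, hx0, hxS, hF.force_zero, hGdef, hF.partialE_origin] at key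
    simp only [sub_self, mul_zero, zero_mul, add_zero, zero_sub, abs_neg] at key
    refine key.trans ?_
    have h3 : 0 ≤ C₁ * (|C| + 1) * e ^ 2 := by positivity
    linarith

end IsSymmetricForce

/-! ### The derivative of the trace. -/

theorem theorem3p2 (F : ℝ → ℝ → ℝ → ℝ) (f : ℝ → ℝ) (hF : IsSymmetricForce F f)
    (m p : ℕ) (hm : 0 < m) (hp : 0 < p)
    (h : ℝ) (h_pos : 0 < h) (h_lt : ∃ x, h < potential f x)
    (h_period : periodFunction f h = 2 * m * Real.pi / p)
    (h_nondeg : deriv (periodFunction f) h ≠ 0)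
    (e₀ : ℝ) (V : ℝ → ℝ) (φ : ℝ → ℝ → ℝ)
    (hφ : IsOddBranch F m (Real.sqrt (2 * h)) e₀ V φ)
    (ψ₁ ψ₂ : ℝ → ℝ → ℝ)
    (hψ : ∀ e ∈ Set.Ico 0 e₀, IsFundamentalPair (linearization F e (φ e)) (ψ₁ e) (ψ₂ e)) :
    HasDerivWithinAt (fun e => poincareTrace (ψ₁ e) (ψ₂ e) (2 * m * Real.pi))
      (-(p : ℝ) * deriv (periodFunction f) h *
        ∫ t in (0 : ℝ)..(2 * m * Real.pi), mixedPartial F (φ 0 t) t 0 * deriv (φ 0) t)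
      (Set.Ici 0) 0 := by
  set S := 2 * m * Real.pi with hSdef
  have hm' : (0 : ℝ) < m := Nat.cast_pos.2 hm
  have hp' : (0 : ℝ) < p := Nat.cast_pos.2 hp
  have hS : 0 < S := by positivity
  set η := Real.sqrt (2 * h) with hηdef
  have hη : 0 < η := Real.sqrt_pos.2 (by linarith)
  have hη2 : η ^ 2 = 2 * h := Real.sq_sqrt (by linarith)
  have h00 : (0 : ℝ) ∈ Ico 0 e₀ := ⟨le_rfl, hφ.pos⟩
  have hx₀ := hφ.solves 0 h00
  have h0 := hφ.initial_position 0 h00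
  have hψ0 := hψ 0 h00
  obtain ⟨hS0, hS1⟩ := hF.reflect_solution hx₀ h0 (hφ.endpoint 0 h00)
  rw [← hSdef] at hS0 hS1
  have hV0 : deriv (φ 0) 0 = η := by rw [hφ.initial_velocity 0 h00, hφ.start]
  -- Since `deriv` is 0 where no derivative exists, `h_nondeg` also makes T differentiable at h.
  have hb : ψ₂ 0 S = -p * η ^ 2 * deriv (periodFunction f) h := by
    rw [hη2]
    exact hF.fundamental_endpoint_eq h_pos hp hx₀ h0 hV0 hS hS0 hS1
      (by rw [h_period]; field_simp) (differentiableAt_of_deriv_ne_zero h_nondeg) hψ0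
  have hb0 : ψ₂ 0 S ≠ 0 := by
    rw [hb]
    exact mul_ne_zero (mul_ne_zero (neg_ne_zero.2 hp'.ne') (pow_ne_zero 2 hη.ne')) h_nondeg
  obtain ⟨hd₁, hd₁', hd₂'⟩ := hF.fundamental_endpoint hx₀ h0 hS.le hS0 hS1
    (by rw [hV0]; exact hη.ne') hψ0
  obtain ⟨C, -, hC⟩ := hF.exists_branch_bound hφ hη hψ0 hb0
  obtain ⟨C₁, hC₁, hvar⟩ := hF.exists_integral_potential_variation hx₀ h0 hS.le hS0 C
  obtain ⟨C₂, r, hC₂, hr, htr⟩ := exists_trace_variation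
    (hF.continuous_linearization 0 hx₀.continuous) hψ0 hS.le hd₁ hd₁' hd₂'
  set T' := deriv (periodFunction f) h
  set I := ∫ t in (0 : ℝ)..S, mixedPartial F (φ 0 t) t 0 * deriv (φ 0) t with hI
  have hmix : Continuous fun t => mixedPartial F (φ 0 t) t 0 := by
    simp only [hF.mixedPartial_eq]
    exact (contDiff_partialT (contDiff_partialE hF.contDiff_uncurry)).continuous.comp
      (hx₀.continuous.prodMk (continuous_id.prodMk continuous_const))
  have hest : ∀ᶠ e in 𝓝[≥] (0 : ℝ),
      |poincareTrace (ψ₁ e) (ψ₂ e) S - poincareTrace (ψ₁ 0) (ψ₂ 0) S - e * (-(p : ℝ) * T' * I)| ≤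
        (C₂ * C₁ ^ 2 + |p * T'| * C₁) * e ^ 2 := by
    have hsmall : ∀ᶠ e in 𝓝[≥] (0 : ℝ), C₁ * e < r := by
      have : Tendsto (fun e : ℝ => C₁ * e) (𝓝[≥] 0) (𝓝 0) := by
        simpa using ((continuous_const_mul C₁).tendsto (0 : ℝ)).mono_left nhdsWithin_le_nhds
      exact this.eventually_lt_const hr
    filter_upwards [hC, hsmall, Ico_mem_nhdsGE hφ.pos, Ico_mem_nhdsGE one_pos]
      with e hCe hre he he1
    have hx := hφ.solves e he
    have hxS := (hF.reflect_solution hx (hφ.initial_position e he) (hφ.endpoint e he)).1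
    obtain ⟨hq, hint⟩ := hvar e (φ e) he.1 he1.2.le hx (hφ.initial_position e he) hxS hCe
    have hqc := hF.continuous_linearization e hx.continuous
    have hq0c := hF.continuous_linearization 0 hx₀.continuous
    have ht := htr _ (ψ₁ e) (ψ₂ e) (C₁ * e) hqc (hψ e he) (mul_nonneg hC₁ he.1) hre.le hq
    have hc₁ : Continuous fun t =>
        (linearization F e (φ e) t - linearization F 0 (φ 0) t) * deriv (φ 0) t ^ 2 :=
      (hqc.sub hq0c).mul (hx₀.continuous_deriv.pow 2)
    have hc₂ : Continuous fun t => e * (mixedPartial F (φ 0 t) t 0 * deriv (φ 0) t) :=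
      continuous_const.mul (hmix.mul hx₀.continuous_deriv)
    rw [intervalIntegral.integral_add (hc₁.intervalIntegrable _ _) (hc₂.intervalIntegrable _ _),
      intervalIntegral.integral_const_mul, ← hI] at hint
    have hcongr : ∫ t in (0 : ℝ)..S, (linearization F e (φ e) t - linearization F 0 (φ 0) t) *
        deriv (φ 0) t ^ 2 = η ^ 2 * ∫ t in (0 : ℝ)..S,
        (linearization F e (φ e) t - linearization F 0 (φ 0) t) * ψ₁ 0 t ^ 2 := by
      rw [← intervalIntegral.integral_const_mul]
      refine intervalIntegral.integral_congr fun t ht => ?_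
      rw [uIcc_of_le hS.le] at ht
      rw [(hF.deriv_eq_mul_fundamental hx₀ h0 hψ0 ht.1).1, hV0]
      ring
    rw [hcongr] at hint
    set J := ∫ t in (0 : ℝ)..S,
      (linearization F e (φ e) t - linearization F 0 (φ 0) t) * ψ₁ 0 t ^ 2
    rw [hb] at ht
    simp only [poincareTrace, Matrix.trace_fin_two_of]
    -- The terms in J cancel between the trace variation and the integral identity, leaving pT'eI.
    calc _ = |(ψ₁ e S + deriv (ψ₂ e) S - (ψ₁ 0 S + deriv (ψ₂ 0) S) + -p * η ^ 2 * T' * J) +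
          p * T' * (η ^ 2 * J + e * I)| := by congr 1; ring
      _ ≤ _ := abs_add_le _ _
      _ ≤ C₂ * (C₁ * e) ^ 2 + |p * T'| * (C₁ * e ^ 2) := by
        rw [abs_mul (p * T')]
        exact add_le_add ht (mul_le_mul_of_nonneg_left hint (abs_nonneg _))
      _ = _ := by ring
  rw [hasDerivWithinAt_iff_isLittleO]
  have hO : (fun e => poincareTrace (ψ₁ e) (ψ₂ e) S - poincareTrace (ψ₁ 0) (ψ₂ 0) S -
      (e - 0) • (-(p : ℝ) * T' * I)) =O[𝓝[≥] 0] fun e => ‖e - 0‖ ^ 2 := by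
    refine Asymptotics.IsBigO.of_bound (C₂ * C₁ ^ 2 + |p * T'| * C₁) ?_
    filter_upwards [hest] with e he
    simpa using he
  exact hO.trans_isLittleO
    ((Asymptotics.isLittleO_pow_sub_sub (0 : ℝ) one_lt_two).mono nhdsWithin_le_nhds)
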